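/- **Theorem 4.1 (Functional equations for complex dilogarithms).** Let $$V=\{(s_1,s_2)\in\mathbb{C}^2 : s_1s_2(1-s_1)(1-s_2)(s_1-s_2)(1-s_1s_2)\neq 0\}$$ be the complement of the non-Fano arrangement, and let $f_1,\dots,f_9:V\to\mathbb{P}^1(\mathbb{C})\setminus\{0,1,\infty\}$ be the maps $$f_1=\frac{s_1(1-s_2)^2}{s_2(1-s_1)^2},\quad f_2=s_1s_2,\quad f_3=\frac{s_1}{s_2},\quad f_4=\frac{s_1(1-s_2)}{s_2(1-s_1)},\quad f_5=\frac{s_1(1-s_2)}{s_1-1},$$ $$f_6=\frac{1-s_2}{1-s_1},\quad f_7=\frac{1-s_2}{s_2(s_1-1)},\quad f_8=s_1,\quad f_9=s_2.$$ Let $\vec v$ be the tangential base point of $V$ given by the arc $t\mapsto(t^2,t)$ as $t\to0^+$, and let $\overrightarrow{01}$ be the tangential base point of $\mathbb{P}^1(\mathbb{C})\setminus\{0,1,\infty\}$ given by $t\mapsto t$ as $t\to0^+$. A path from a tangential base point starts along its arc. Write $\pi_1^{\rm top}(X;*,*')$ for the set of homotopy classes of paths on $X$ from $*$ to $*'$,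 and compose paths from left to right. Let $\delta_i\in\pi_1^{\rm top}(\mathbb{P}^1(\mathbb{C})\setminus\{0,1,\infty\};\overrightarrow{01},f_i(\vec v))$, where $f_i(\vec v)$ is given by the arc $t\mapsto f_i(t^2,t)$, be the following paths: * for $i=1,2,3,4,8,9$ (the arc $f_i(\vec v)$ tends to $0$ through $(0,1)$), $\delta_i$ is the trivial path, i.e. it stays in the real interval $(0,1)$; * for $i=5$ (the arc tends to $0$ through the negative reals), $\delta_5$ is the half turn around $0$ through the upper half plane; * for $i=6$ (the arc tends to $1$ through $(0,1)$), $\delta_6$ is the straight path along $(0,1)$; * for $i=7$ (the arc tends to $-\infty$ through the negative reals), $\delta_7$ is the path through the upper half plane. For $\gamma\in\pi_1^{\rm top}(\mathbb{P}^1(\mathbb{C})\setminus\{0,1,\infty\};\overrightarrow{01},z)$ put $$\log(z;\gamma)=\int_{\delta^{-1}\cdot\gamma}\frac{dt}{t},\qquad Li_1(z;\gamma)=\int_\gamma\frac{dt}{1-t},\qquad Li_2(z;\gamma)=\int_\gamma Li_1(t;\gamma_t)\,\frac{dt}{t},$$ where $\delta$ is the straight path from $0$ to $1$ along $(0,1)$,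 so that $\delta^{-1}\cdot\gamma$ starts at $1$, and $\gamma_t$ is the part of $\gamma$ that ends at $t$. Let $(x,y)\in V$, let $\gamma_0\in\pi_1^{\rm top}(V;\vec v,(x,y))$, and put $\gamma_i=\delta_i\cdot f_i(\gamma_0)\in\pi_1^{\rm top}(\mathbb{P}^1(\mathbb{C})\setminus\{0,1,\infty\};\overrightarrow{01},f_i(x,y))$ for $i=1,\dots,9$. Then the following hold. (a) (Schaeffer's equation) $$Li_2\Big(\tfrac{x(1-y)}{y(1-x)};\gamma_4\Big)-Li_2(y;\gamma_9)+Li_2(x;\gamma_8)-Li_2\Big(\tfrac{x}{y};\gamma_3\Big)-Li_2\Big(\tfrac{1-y}{1-x};\gamma_6\Big)=\log(y;\gamma_9)\log\Big(\tfrac{1-y}{1-x};\gamma_6\Big)-\frac{\pi^2}{6}.$$ (b) (Kummer's equation) $$Li_2\Big(\tfrac{x(1-y)^2}{y(1-x)^2};\gamma_1\Big)-Li_2\Big(\tfrac{x(1-y)}{x-1};\gamma_5\Big)-Li_2\Big(\tfrac{1-y}{y(x-1)};\gamma_7\Big)-Li_2\Big(\tfrac{x(1-y)}{y(1-x)};\gamma_4\Big)-Li_2\Big(\tfrac{1-y}{1-x};\gamma_6\Big)=\frac12\log^2(y;\gamma_9).$$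 (c) (Hill's equation) $$Li_2\Big(\tfrac{1-y}{y(x-1)};\gamma_7\Big)+Li_2(xy;\gamma_2)-Li_2(x;\gamma_8)-Li_2(y;\gamma_9)-Li_2\Big(\tfrac{x(1-y)}{x-1};\gamma_5\Big)=-\frac{\pi^2}{6}+\log(y;\gamma_9)\log\Big(\tfrac{1-y}{1-x};\gamma_6\Big)-\frac12\log^2(y;\gamma_9).$$ -/

import Mathlib

namespace SpenceKummer

open Set

/-! ### Homotopy classes of paths between (possibly tangential) base points -/

/-- The parameter interval of tangential base points. -/
abbrev Germ : Type := Ioo (0 : ℝ) 1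

/-- A (possibly tangential) base point of a topological space `X`, given by an arc
`c : (0, 1) → X`.  The tangential base point is approached by `c t` as `t → 0+`.
Since the arc itself lies in `X` and its parameter interval is contractible, a path that leaves the
tangential base point runs along the arc from `c 0+` up to some `c t`, and then goes on
from `c t` in `X`. -/
abbrev BasePoint (X : Type*) [TopologicalSpace X] : Type _ := C(Germ, X)

/-- An ordinary point, viewed as a base point (constant arc). -/
abbrev BasePoint.ofPoint {X : Type*} [TopologicalSpace X] (p : X) : BasePoint X :=
  ContinuousMap.const Germ p

/-- The image `f(c)` of a base point under a continuous map. -/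
abbrev BasePoint.map {X Y : Type*} [TopologicalSpace X] [TopologicalSpace Y]
    (f : C(X, Y)) (c : BasePoint X) : BasePoint Y :=
  f.comp c

/-- A path in `X` from the base point `c` to the base point `d`: it runs along `c` from the
tangential end up to the parameter `source`, then along `path`, and then along `d` from the
parameter `target` to the tangential end. -/
structure TangentialPath {X : Type*} [TopologicalSpace X] (c d : BasePoint X) where
  source : Germ
  target : Germ
  path : Path (c source) (d target)

/-- Two paths from `c` to `d` are homotopic if they are so (with fixed ends) once the cut points
have been moved, along the arcs `c` and `d`, to the same place. -/
def TangentialPath.Homotopic {X : Type*} [TopologicalSpace X] {c d : BasePoint X}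
    (p q : TangentialPath c d) : Prop :=
  ∃ (σ : Path p.source q.source) (τ : Path p.target q.target),
    (p.path.trans (τ.map d.continuous)).Homotopic ((σ.map c.continuous).trans q.path)

instance germ_contractible : ContractibleSpace Germ :=
  (convex_Ioo (0 : ℝ) 1).contractibleSpace ⟨1 / 2, by norm_num, by norm_num⟩

/-- Any two paths with the same ends in the parameter interval have homotopic images. -/
theorem germ_path_map_eq {X : Type*} [TopologicalSpace X] (c : BasePoint X) {s t : Germ}
    (σ τ : Path s t) :
    Path.Homotopic.Quotient.mk (σ.map c.continuous) =
      Path.Homotopic.Quotient.mk (τ.map c.continuous) :=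
  Path.Homotopic.Quotient.eq.2 ((SimplyConnectedSpace.paths_homotopic σ τ).map c)

theorem TangentialPath.homotopic_iff {X : Type*} [TopologicalSpace X] {c d : BasePoint X}
    (p q : TangentialPath c d) :
    p.Homotopic q ↔ ∃ (σ : Path p.source q.source) (τ : Path p.target q.target),
      (Path.Homotopic.Quotient.mk p.path).trans (Path.Homotopic.Quotient.mk (τ.map d.continuous)) =
        (Path.Homotopic.Quotient.mk (σ.map c.continuous)).trans (Path.Homotopic.Quotient.mk q.path) := by
  simp only [TangentialPath.Homotopic, ← Path.Homotopic.Quotient.mk_trans, Path.Homotopic.Quotient.eq]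

theorem TangentialPath.homotopic_equivalence {X : Type*} [TopologicalSpace X]
    (c d : BasePoint X) :
    Equivalence (TangentialPath.Homotopic : TangentialPath c d → TangentialPath c d → Prop) := by
  refine ⟨fun p => ?_, fun {p q} h => ?_, fun {p q r} h h' => ?_⟩
  · rw [TangentialPath.homotopic_iff]
    refine ⟨Path.refl _, Path.refl _, ?_⟩
    have hr : ∀ (e : BasePoint X) (s : Germ),
        (Path.refl s).map e.continuous = Path.refl (e s) := fun e s => rfl
    simp [hr]
  · rw [TangentialPath.homotopic_iff] at h ⊢
    obtain ⟨σ, τ, h⟩ := h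
    refine ⟨σ.symm, τ.symm, ?_⟩
    have hs : ∀ (e : BasePoint X) {s t : Germ} (σ : Path s t),
        σ.symm.map e.continuous = (σ.map e.continuous).symm := fun e s t σ => rfl
    rw [hs, hs]
    have h1 : Path.Homotopic.Quotient.mk q.path = (Path.Homotopic.Quotient.symm (Path.Homotopic.Quotient.mk (σ.map c.continuous))).trans
        ((Path.Homotopic.Quotient.mk p.path).trans (Path.Homotopic.Quotient.mk (τ.map d.continuous))) := by
      rw [h, ← Path.Homotopic.Quotient.trans_assoc, Path.Homotopic.Quotient.symm_trans, Path.Homotopic.Quotient.refl_trans]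
    rw [h1]
    simp only [Path.Homotopic.Quotient.mk_symm, Path.Homotopic.Quotient.trans_assoc, Path.Homotopic.Quotient.trans_symm, Path.Homotopic.Quotient.trans_refl]
  · rw [TangentialPath.homotopic_iff] at h h' ⊢
    obtain ⟨σ, τ, h⟩ := h
    obtain ⟨σ', τ', h'⟩ := h'
    refine ⟨σ.trans σ', τ.trans τ', ?_⟩
    rw [Path.map_trans, Path.map_trans, Path.Homotopic.Quotient.mk_trans, Path.Homotopic.Quotient.mk_trans,
      ← Path.Homotopic.Quotient.trans_assoc, h, Path.Homotopic.Quotient.trans_assoc, h', Path.Homotopic.Quotient.trans_assoc]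

/-- Homotopy of paths from `c` to `d`, as an equivalence relation. -/
def tangentialSetoid {X : Type*} [TopologicalSpace X] (c d : BasePoint X) :
    Setoid (TangentialPath c d) :=
  ⟨TangentialPath.Homotopic, TangentialPath.homotopic_equivalence c d⟩

/-- The set `π₁(X; c, d)` of homotopy classes of paths from `c` to `d`. -/
def PathClass {X : Type*} [TopologicalSpace X] (c d : BasePoint X) : Type _ :=
  Quotient (tangentialSetoid c d)

/-- The homotopy class of a path. -/
def PathClass.mk {X : Type*} [TopologicalSpace X] {c d : BasePoint X}
    (p : TangentialPath c d) : PathClass c d :=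
  Quotient.mk (tangentialSetoid c d) p

/-- The image of a path under a continuous map. -/
def TangentialPath.map {X Y : Type*} [TopologicalSpace X] [TopologicalSpace Y]
    {c d : BasePoint X} (f : C(X, Y)) (p : TangentialPath c d) :
    TangentialPath (c.map f) (d.map f) :=
  ⟨p.source, p.target, p.path.map f.continuous⟩

/-- The map `π₁(X; c, d) → π₁(Y; f(c), f(d))` induced by a continuous map `f`. -/
def PathClass.map {X Y : Type*} [TopologicalSpace X] [TopologicalSpace Y]
    {c d : BasePoint X} (f : C(X, Y)) (γ : PathClass c d) :
    PathClass (c.map f) (d.map f) :=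
  Quotient.map (sa := tangentialSetoid c d) (sb := tangentialSetoid (c.map f) (d.map f))
    (TangentialPath.map f)
    (by
      rintro p q ⟨σ, τ, h⟩
      refine ⟨σ, τ, ?_⟩
      have h2 := h.map f
      rw [Path.map_trans, Path.map_trans] at h2
      exact h2) γ

/-- Some path between two points of the parameter interval (all of them are homotopic). -/
noncomputable def germPath (s t : Germ) : Path s t :=
  PathConnectedSpace.somePath s t

/-- Composition of paths: first `p` from `c` to `d`, then `q` from `d` to `e`.  The two pieces are
joined along the arc `d`. -/
noncomputable def TangentialPath.comp {X : Type*} [TopologicalSpace X] {c d e : BasePoint X}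
    (p : TangentialPath c d) (q : TangentialPath d e) : TangentialPath c e :=
  ⟨p.source, q.target,
    (p.path.trans ((germPath p.target q.source).map d.continuous)).trans q.path⟩

/-- Composition `π₁(X; c, d) × π₁(X; d, e) → π₁(X; c, e)` of homotopy classes, written from left to
right. -/
noncomputable def PathClass.comp {X : Type*} [TopologicalSpace X] {c d e : BasePoint X}
    (δ : PathClass c d) (γ : PathClass d e) : PathClass c e :=
  Quotient.map₂ (sa := tangentialSetoid c d) (sb := tangentialSetoid d e)
    (sc := tangentialSetoid c e) TangentialPath.comp
    (by
      intro p p' hp q q' hq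
      obtain ⟨σ, τ, h⟩ := (TangentialPath.homotopic_iff p p').1 hp
      obtain ⟨σ', τ', h'⟩ := (TangentialPath.homotopic_iff q q').1 hq
      refine (TangentialPath.homotopic_iff _ _).2 ⟨σ, τ', ?_⟩
      have key : Path.Homotopic.Quotient.mk ((germPath p.target q.source).map d.continuous) =
          (Path.Homotopic.Quotient.mk (τ.map d.continuous)).trans
            ((Path.Homotopic.Quotient.mk ((germPath p'.target q'.source).map d.continuous)).trans
              (Path.Homotopic.Quotient.symm (Path.Homotopic.Quotient.mk (σ'.map d.continuous)))) := by
        rw [← Path.Homotopic.Quotient.mk_symm, ← Path.Homotopic.Quotient.mk_trans, ← Path.Homotopic.Quotient.mk_trans]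
        have e1 : (σ'.map d.continuous).symm = σ'.symm.map d.continuous := rfl
        rw [e1, ← Path.map_trans, ← Path.map_trans]
        exact germ_path_map_eq d _ _
      have h2 : Path.Homotopic.Quotient.mk q.path = ((Path.Homotopic.Quotient.mk (σ'.map d.continuous)).trans
          (Path.Homotopic.Quotient.mk q'.path)).trans
            (Path.Homotopic.Quotient.symm (Path.Homotopic.Quotient.mk (τ'.map e.continuous))) := by
        rw [← h', Path.Homotopic.Quotient.trans_assoc, Path.Homotopic.Quotient.trans_symm, Path.Homotopic.Quotient.trans_refl]
      have goal : (Path.Homotopic.Quotient.mk ((p.path.trans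
          ((germPath p.target q.source).map d.continuous)).trans q.path)).trans
            (Path.Homotopic.Quotient.mk (τ'.map e.continuous)) =
          (Path.Homotopic.Quotient.mk (σ.map c.continuous)).trans (Path.Homotopic.Quotient.mk
            ((p'.path.trans ((germPath p'.target q'.source).map d.continuous)).trans q'.path)) := by
        simp only [Path.Homotopic.Quotient.mk_trans, Path.Homotopic.Quotient.trans_assoc]
        rw [← Path.Homotopic.Quotient.trans_assoc (Path.Homotopic.Quotient.mk (σ.map c.continuous)), ← h, key, h2]
        simp only [Path.Homotopic.Quotient.trans_assoc, Path.Homotopic.Quotient.symm_trans, Path.Homotopic.Quotient.trans_refl]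
        rw [← Path.Homotopic.Quotient.trans_assoc (Path.Homotopic.Quotient.symm (Path.Homotopic.Quotient.mk (σ'.map d.continuous))), Path.Homotopic.Quotient.symm_trans, Path.Homotopic.Quotient.refl_trans]
      exact goal) δ γ

/-! ### The spaces and the nine maps -/

/-- The complex points of `ℙ¹ ∖ {0, 1, ∞}`. -/
abbrev P1 : Type := {z : ℂ // z ≠ 0 ∧ z ≠ 1}

/-- The complex points of the complement of the non-Fano arrangement. -/
abbrev VnonFano : Type :=
  {s : ℂ × ℂ // s.1 * s.2 * (1 - s.1) * (1 - s.2) * (s.1 - s.2) * (1 - s.1 * s.2) ≠ 0}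

theorem VnonFano.ne (p : VnonFano) : p.1.1 ≠ 0 ∧ p.1.2 ≠ 0 ∧ 1 - p.1.1 ≠ 0 ∧ 1 - p.1.2 ≠ 0 ∧
    p.1.1 - p.1.2 ≠ 0 ∧ 1 - p.1.1 * p.1.2 ≠ 0 := by
  have h := p.2
  simp only [mul_ne_zero_iff] at h
  tauto

theorem VnonFano.ne' (p : VnonFano) : p.1.1 - 1 ≠ 0 := by
  have h := p.ne.2.2.1
  intro h0
  apply h
  linear_combination -h0

noncomputable def f₁ : C(VnonFano, P1) where
  toFun p := ⟨p.1.1 * (1 - p.1.2) ^ 2 / (p.1.2 * (1 - p.1.1) ^ 2), by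
    obtain ⟨h1, h2, h3, h4, h5, h6⟩ := p.ne
    refine ⟨by positivity, fun h => ?_⟩
    rw [div_eq_one_iff_eq (by positivity)] at h
    apply mul_ne_zero h5 h6
    linear_combination h⟩
  continuous_toFun := by
    refine Continuous.subtype_mk (Continuous.div (by fun_prop) (by fun_prop) fun p => ?_) _
    obtain ⟨h1, h2, h3, h4, h5, h6⟩ := p.ne
    positivity

noncomputable def f₂ : C(VnonFano, P1) where
  toFun p := ⟨p.1.1 * p.1.2, by
    obtain ⟨h1, h2, h3, h4, h5, h6⟩ := p.ne
    refine ⟨by positivity, fun h => h6 ?_⟩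
    linear_combination -h⟩
  continuous_toFun := by
    refine Continuous.subtype_mk (by fun_prop) _

noncomputable def f₃ : C(VnonFano, P1) where
  toFun p := ⟨p.1.1 / p.1.2, by
    obtain ⟨h1, h2, h3, h4, h5, h6⟩ := p.ne
    refine ⟨by positivity, fun h => h5 ?_⟩
    rw [div_eq_one_iff_eq h2] at h
    linear_combination h⟩
  continuous_toFun := by
    refine Continuous.subtype_mk (Continuous.div (by fun_prop) (by fun_prop) fun p => ?_) _
    exact p.ne.2.1

noncomputable def f₄ : C(VnonFano, P1) where
  toFun p := ⟨p.1.1 * (1 - p.1.2) / (p.1.2 * (1 - p.1.1)), by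
    obtain ⟨h1, h2, h3, h4, h5, h6⟩ := p.ne
    refine ⟨by positivity, fun h => h5 ?_⟩
    rw [div_eq_one_iff_eq (by positivity)] at h
    linear_combination h⟩
  continuous_toFun := by
    refine Continuous.subtype_mk (Continuous.div (by fun_prop) (by fun_prop) fun p => ?_) _
    obtain ⟨h1, h2, h3, h4, h5, h6⟩ := p.ne
    positivity

noncomputable def f₅ : C(VnonFano, P1) where
  toFun p := ⟨p.1.1 * (1 - p.1.2) / (p.1.1 - 1), by
    obtain ⟨h1, h2, h3, h4, h5, h6⟩ := p.ne
    have h7 := p.ne'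
    refine ⟨by positivity, fun h => h6 ?_⟩
    rw [div_eq_one_iff_eq h7] at h
    linear_combination h⟩
  continuous_toFun := by
    refine Continuous.subtype_mk (Continuous.div (by fun_prop) (by fun_prop) fun p => ?_) _
    exact p.ne'

noncomputable def f₆ : C(VnonFano, P1) where
  toFun p := ⟨(1 - p.1.2) / (1 - p.1.1), by
    obtain ⟨h1, h2, h3, h4, h5, h6⟩ := p.ne
    refine ⟨by positivity, fun h => h5 ?_⟩
    rw [div_eq_one_iff_eq h3] at h
    linear_combination h⟩
  continuous_toFun := by
    refine Continuous.subtype_mk (Continuous.div (by fun_prop) (by fun_prop) fun p => ?_) _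
    exact p.ne.2.2.1

noncomputable def f₇ : C(VnonFano, P1) where
  toFun p := ⟨(1 - p.1.2) / (p.1.2 * (p.1.1 - 1)), by
    obtain ⟨h1, h2, h3, h4, h5, h6⟩ := p.ne
    have h7 := p.ne'
    refine ⟨by positivity, fun h => h6 ?_⟩
    rw [div_eq_one_iff_eq (by positivity)] at h
    linear_combination h⟩
  continuous_toFun := by
    refine Continuous.subtype_mk (Continuous.div (by fun_prop) (by fun_prop) fun p => ?_) _
    have h2 := p.ne.2.1
    have h7 := p.ne'
    positivity

noncomputable def f₈ : C(VnonFano, P1) where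
  toFun p := ⟨p.1.1, p.ne.1, fun h => p.ne' (by rw [h, sub_self])⟩
  continuous_toFun := by
    refine Continuous.subtype_mk (by fun_prop) _

noncomputable def f₉ : C(VnonFano, P1) where
  toFun p := ⟨p.1.2, p.ne.2.1, fun h => p.ne.2.2.2.1 (by rw [h, sub_self])⟩
  continuous_toFun := by
    refine Continuous.subtype_mk (by fun_prop) _

/-! ### Tangential base points and the paths `δ` -/

theorem Germ.ofReal_ne (t : Germ) : ((t : ℝ) : ℂ) ≠ 0 ∧ ((t : ℝ) : ℂ) ≠ 1 :=
  ⟨by exact_mod_cast t.2.1.ne', by exact_mod_cast t.2.2.ne⟩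

/-- The standard tangential base point `01` of `ℙ¹ ∖ {0, 1, ∞}`: the germ at `0` of the arc
`t ↦ t`. -/
noncomputable def tan01 : BasePoint P1 where
  toFun t := ⟨((t : ℝ) : ℂ), Germ.ofReal_ne t⟩
  continuous_toFun := by
    refine Continuous.subtype_mk (by fun_prop) _

/-- The tangential base point of the complement of the non-Fano arrangement over the point
`(t², t)`. -/
noncomputable def tanV : BasePoint VnonFano where
  toFun t := ⟨(((t : ℝ) : ℂ) ^ 2, ((t : ℝ) : ℂ)), by
    obtain ⟨t, h0, h1⟩ := t
    have hr : t ^ 2 * t * (1 - t ^ 2) * (1 - t) * (t ^ 2 - t) * (1 - t ^ 2 * t) ≠ 0 := by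
      have a1 : 1 - t ≠ 0 := by linarith [h1] |> fun (h : 0 < 1 - t) => h.ne'
      have a2 : 1 - t ^ 2 ≠ 0 := (by nlinarith : 0 < 1 - t ^ 2).ne'
      have a3 : t ^ 2 - t ≠ 0 := (by nlinarith : t ^ 2 - t < 0).ne
      have a4 : 1 - t ^ 2 * t ≠ 0 := (by nlinarith : 0 < 1 - t ^ 2 * t).ne'
      have a0 : t ≠ 0 := h0.ne'
      positivity
    have hc := Complex.ofReal_ne_zero.2 hr
    push_cast at hc
    exact hc⟩
  continuous_toFun := by
    refine Continuous.subtype_mk (by fun_prop) _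

/-- The parameter `1 / 2`. -/
noncomputable def Germ.half : Germ := ⟨1 / 2, by norm_num, by norm_num⟩

/-- The straight path inside the real interval `(0, 1)` from `01` to a base point `c` whose arc lies
in that interval.  If the arc `c` tends to `0` from the right, this is the trivial path (under the
identification of `c` with `01`); if it tends to `1` from the left (tangential base point `10`),
this is the straight path along the unit interval. -/
noncomputable def deltaStraight (c : BasePoint P1)
    (hc : ∀ t, ∃ r : ℝ, 0 < r ∧ r < 1 ∧ (c t : ℂ) = r) : PathClass tan01 c :=
  PathClass.mk
    { source := Germ.half
      target := Germ.half
      path :=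
        { toFun := fun s => ⟨(1 - (s : ℝ)) * (tan01 Germ.half : ℂ) + (s : ℝ) * (c Germ.half : ℂ), by
            obtain ⟨r, h0, h1, hr⟩ := hc Germ.half
            obtain ⟨s, hs0, hs1⟩ := s
            have e : (1 - ((s : ℝ) : ℂ)) * (tan01 Germ.half : ℂ) + ((s : ℝ) : ℂ) * (c Germ.half : ℂ)
                = (((1 - s) * (1 / 2) + s * r : ℝ) : ℂ) := by
              rw [hr]
              simp [tan01, Germ.half]
            change (1 - ((s : ℝ) : ℂ)) * (tan01 Germ.half : ℂ) + ((s : ℝ) : ℂ) * (c Germ.half : ℂ) ≠ 0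
              ∧ (1 - ((s : ℝ) : ℂ)) * (tan01 Germ.half : ℂ) + ((s : ℝ) : ℂ) * (c Germ.half : ℂ) ≠ 1
            rw [e]
            constructor
            · have : 0 < (1 - s) * (1 / 2) + s * r := by
                rcases hs1.lt_or_eq with h | h
                · have := mul_nonneg hs0 h0.le
                  linarith
                · subst h
                  linarith
              exact_mod_cast this.ne'
            · have : (1 - s) * (1 / 2) + s * r < 1 := by
                rcases hs0.lt_or_eq with h | h
                · nlinarith
                · subst h
                  norm_num
              exact_mod_cast this.ne⟩
          continuous_toFun := by
            refine Continuous.subtype_mk (by fun_prop) _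
          source' := by
            apply Subtype.ext
            simp
          target' := by
            apply Subtype.ext
            simp } }

/-- The path through the upper half plane from `01` to a base point `c` whose arc lies on the
negative real axis: the half turn `s ↦ R(s) * exp (π i s)`, where `R > 0` is the affine
interpolation of the absolute values.  If the arc `c` tends to `0` (tangential base point `0∞`),
this is the positive half turn around `0`; if it tends to `-∞` (tangential base point `∞0`), this
is the path from `01` to `∞0` through the upper half plane. -/
noncomputable def deltaUpper (c : BasePoint P1)
    (hc : ∀ t, ∃ r : ℝ, 0 < r ∧ (c t : ℂ) = -r) : PathClass tan01 c :=
  PathClass.mk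
    { source := Germ.half
      target := Germ.half
      path :=
        { toFun := fun s => ⟨((1 - (s : ℝ)) * (1 / 2) + (s : ℝ) * ‖(c Germ.half : ℂ)‖ : ℝ) *
              Complex.exp (Real.pi * Complex.I * (s : ℝ)), by
            obtain ⟨r, h0, hr⟩ := hc Germ.half
            obtain ⟨s, hs0, hs1⟩ := s
            have hn : ‖(c Germ.half : ℂ)‖ = r := by
              rw [hr, norm_neg, Complex.norm_real, Real.norm_eq_abs, abs_of_pos h0]
            have hpos : 0 < (1 - s) * (1 / 2) + s * r := by
              rcases hs1.lt_or_eq with h | h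
              · have := mul_nonneg hs0 h0.le
                linarith
              · subst h
                linarith
            rw [hn]
            refine ⟨mul_ne_zero (by exact_mod_cast hpos.ne') (Complex.exp_ne_zero _), fun h => ?_⟩
            have e : (Real.pi : ℂ) * Complex.I * ((s : ℝ) : ℂ) = ((Real.pi * s : ℝ) : ℂ) * Complex.I := by
              push_cast
              ring
            change (((1 - s) * (1 / 2) + s * r : ℝ) : ℂ) *
              Complex.exp ((Real.pi : ℂ) * Complex.I * ((s : ℝ) : ℂ)) = 1 at h
            rw [e] at h
            have him := congrArg Complex.im h
            have hre := congrArg Complex.re h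
            rw [Complex.re_ofReal_mul, Complex.exp_ofReal_mul_I_re, Complex.one_re] at hre
            rw [Complex.im_ofReal_mul, Complex.exp_ofReal_mul_I_im, Complex.one_im] at him
            have hsin : Real.sin (Real.pi * s) = 0 := by
              rcases mul_eq_zero.1 him with h' | h'
              · exact absurd h' hpos.ne'
              · exact h'
            rcases hs0.lt_or_eq with h1 | h1
            · rcases hs1.lt_or_eq with h2 | h2
              · have : 0 < Real.sin (Real.pi * s) :=
                  Real.sin_pos_of_pos_of_lt_pi (by positivity)
                    (by nlinarith [Real.pi_pos])
                exact this.ne' hsin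
              · subst h2
                rw [mul_one, Real.cos_pi] at hre
                nlinarith
            · subst h1
              norm_num at hre⟩
          continuous_toFun := by
            refine Continuous.subtype_mk (by fun_prop) _
          source' := by
            apply Subtype.ext
            simp [tan01, Germ.half]
          target' := by
            obtain ⟨r, h0, hr⟩ := hc Germ.half
            apply Subtype.ext
            simp [hr, abs_of_pos h0] } }

theorem map_tanV_pos₁ (t : Germ) :
    ∃ r : ℝ, 0 < r ∧ r < 1 ∧ (BasePoint.map f₁ tanV t : ℂ) = r := by
  obtain ⟨t, h0, h1⟩ := t
  refine ⟨t / (1 + t) ^ 2, by positivity, ?_, ?_⟩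
  · rw [div_lt_one (by positivity)]
    nlinarith
  · have a1 : (1 - t) ≠ 0 := (sub_pos.2 h1).ne'
    have e : t ^ 2 * (1 - t) ^ 2 / (t * (1 - t ^ 2) ^ 2) = t / (1 + t) ^ 2 := by
      rw [show (1 - t ^ 2) = (1 - t) * (1 + t) by ring]
      have a2 : 1 + t ≠ 0 := by positivity
      have a3 : t ≠ 0 := h0.ne'
      field_simp
    rw [← e]
    simp [f₁, tanV]

theorem map_tanV_pos₂ (t : Germ) :
    ∃ r : ℝ, 0 < r ∧ r < 1 ∧ (BasePoint.map f₂ tanV t : ℂ) = r := by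
  obtain ⟨t, h0, h1⟩ := t
  refine ⟨t ^ 2 * t, by positivity, by nlinarith, by simp [f₂, tanV]⟩

theorem map_tanV_pos₃ (t : Germ) :
    ∃ r : ℝ, 0 < r ∧ r < 1 ∧ (BasePoint.map f₃ tanV t : ℂ) = r := by
  obtain ⟨t, h0, h1⟩ := t
  refine ⟨t, h0, h1, ?_⟩
  have e : t ^ 2 / t = t := by
    have a3 : t ≠ 0 := h0.ne'
    field_simp
  conv_rhs => rw [← e]
  simp [f₃, tanV]

theorem map_tanV_pos₄ (t : Germ) :
    ∃ r : ℝ, 0 < r ∧ r < 1 ∧ (BasePoint.map f₄ tanV t : ℂ) = r := by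
  obtain ⟨t, h0, h1⟩ := t
  refine ⟨t / (1 + t), by positivity, ?_, ?_⟩
  · rw [div_lt_one (by positivity)]
    linarith
  · have a1 : (1 - t) ≠ 0 := (sub_pos.2 h1).ne'
    have e : t ^ 2 * (1 - t) / (t * (1 - t ^ 2)) = t / (1 + t) := by
      rw [show (1 - t ^ 2) = (1 - t) * (1 + t) by ring]
      have a2 : 1 + t ≠ 0 := by positivity
      have a3 : t ≠ 0 := h0.ne'
      field_simp
    rw [← e]
    simp [f₄, tanV]

theorem map_tanV_neg₅ (t : Germ) :
    ∃ r : ℝ, 0 < r ∧ (BasePoint.map f₅ tanV t : ℂ) = -r := by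
  obtain ⟨t, h0, h1⟩ := t
  refine ⟨t ^ 2 / (1 + t), by positivity, ?_⟩
  have a1 : (1 - t) ≠ 0 := (sub_pos.2 h1).ne'
  have e : t ^ 2 * (1 - t) / (t ^ 2 - 1) = -(t ^ 2 / (1 + t)) := by
    rw [show (t ^ 2 - 1) = -((1 - t) * (1 + t)) by ring]
    have a2 : 1 + t ≠ 0 := by positivity
    have a3 : t ≠ 0 := h0.ne'
    field_simp
  rw [← Complex.ofReal_neg, ← e]
  simp [f₅, tanV]

theorem map_tanV_pos₆ (t : Germ) :
    ∃ r : ℝ, 0 < r ∧ r < 1 ∧ (BasePoint.map f₆ tanV t : ℂ) = r := by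
  obtain ⟨t, h0, h1⟩ := t
  refine ⟨1 / (1 + t), by positivity, ?_, ?_⟩
  · rw [div_lt_one (by positivity)]
    linarith
  · have a1 : (1 - t) ≠ 0 := (sub_pos.2 h1).ne'
    have e : (1 - t) / (1 - t ^ 2) = 1 / (1 + t) := by
      rw [show (1 - t ^ 2) = (1 - t) * (1 + t) by ring]
      have a2 : 1 + t ≠ 0 := by positivity
      field_simp
    rw [← e]
    simp [f₆, tanV]

theorem map_tanV_neg₇ (t : Germ) :
    ∃ r : ℝ, 0 < r ∧ (BasePoint.map f₇ tanV t : ℂ) = -r := by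
  obtain ⟨t, h0, h1⟩ := t
  refine ⟨1 / (t * (1 + t)), by positivity, ?_⟩
  have a1 : (1 - t) ≠ 0 := (sub_pos.2 h1).ne'
  have e : (1 - t) / (t * (t ^ 2 - 1)) = -(1 / (t * (1 + t))) := by
    rw [show (t ^ 2 - 1) = -((1 - t) * (1 + t)) by ring]
    have a2 : 1 + t ≠ 0 := by positivity
    have a3 : t ≠ 0 := h0.ne'
    field_simp
  rw [← Complex.ofReal_neg, ← e]
  simp [f₇, tanV]

theorem map_tanV_pos₈ (t : Germ) :
    ∃ r : ℝ, 0 < r ∧ r < 1 ∧ (BasePoint.map f₈ tanV t : ℂ) = r := by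
  obtain ⟨t, h0, h1⟩ := t
  refine ⟨t ^ 2, by positivity, by nlinarith, by simp [f₈, tanV]⟩

theorem map_tanV_pos₉ (t : Germ) :
    ∃ r : ℝ, 0 < r ∧ r < 1 ∧ (BasePoint.map f₉ tanV t : ℂ) = r := by
  obtain ⟨t, h0, h1⟩ := t
  exact ⟨t, h0, h1, by simp [f₉, tanV]⟩

noncomputable def δ₁ : PathClass tan01 (BasePoint.map f₁ tanV) := deltaStraight _ map_tanV_pos₁
noncomputable def δ₂ : PathClass tan01 (BasePoint.map f₂ tanV) := deltaStraight _ map_tanV_pos₂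
noncomputable def δ₃ : PathClass tan01 (BasePoint.map f₃ tanV) := deltaStraight _ map_tanV_pos₃
noncomputable def δ₄ : PathClass tan01 (BasePoint.map f₄ tanV) := deltaStraight _ map_tanV_pos₄
noncomputable def δ₅ : PathClass tan01 (BasePoint.map f₅ tanV) := deltaUpper _ map_tanV_neg₅
noncomputable def δ₆ : PathClass tan01 (BasePoint.map f₆ tanV) := deltaStraight _ map_tanV_pos₆
noncomputable def δ₇ : PathClass tan01 (BasePoint.map f₇ tanV) := deltaUpper _ map_tanV_neg₇
noncomputable def δ₈ : PathClass tan01 (BasePoint.map f₈ tanV) := deltaStraight _ map_tanV_pos₈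
noncomputable def δ₉ : PathClass tan01 (BasePoint.map f₉ tanV) := deltaStraight _ map_tanV_pos₉

/-- The path `δ · f(γ₀)` from `01` to `f(p)`, for a path `γ₀` on the complement of the non-Fano
arrangement from its tangential base point to the point `p`. -/
noncomputable def transport (f : C(VnonFano, P1)) (δ : PathClass tan01 (BasePoint.map f tanV))
    {p : VnonFano} (γ₀ : PathClass tanV (BasePoint.ofPoint p)) :
    PathClass tan01 (BasePoint.ofPoint (f p)) :=
  δ.comp (γ₀.map f)

/-! ### Logarithm and dilogarithm along a path -/

/-- The path `p`, as a path in `ℂ` parametrized by `[0, source + 1]`: it runs from `0` to `source`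
along the real axis and then along `p.path`. -/
noncomputable def fullPath {z : P1} (p : TangentialPath tan01 (BasePoint.ofPoint z)) : ℝ → ℂ :=
  fun s => if s ≤ (p.source : ℝ) then (s : ℂ) else (p.path.extend (s - (p.source : ℝ)) : ℂ)

/-- `∫ dt/(1-t)` along the piece `[0, s]` of the path `q`. -/
noncomputable def li1Along (q : ℝ → ℂ) (s : ℝ) : ℂ :=
  ∫ u in (0 : ℝ)..s, deriv q u / (1 - q u)

/-- `∫ Li₁(t) dt/t` along the piece `[0, s]` of the path `q`. -/
noncomputable def li2Along (q : ℝ → ℂ) (s : ℝ) : ℂ :=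
  ∫ u in (0 : ℝ)..s, li1Along q u * (deriv q u / q u)

/-- Continuously differentiable paths, along which line integrals are computed. -/
def TangentialPath.IsC1 {z : P1} (p : TangentialPath tan01 (BasePoint.ofPoint z)) : Prop :=
  ContDiffOn ℝ 1 (fun s => (p.path.extend s : ℂ)) (Icc 0 1)

/-- Every homotopy class contains a continuously differentiable path. -/
theorem exists_isC1 {z : P1} (γ : PathClass tan01 (BasePoint.ofPoint z)) :
    ∃ p : TangentialPath tan01 (BasePoint.ofPoint z), p.IsC1 ∧ PathClass.mk p = γ := by
  induction γ using Quotient.ind with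
  | _ p =>
  let g : C(unitInterval, ℂ) := ⟨fun s => (p.path s : ℂ), by fun_prop⟩
  obtain ⟨r, hr0, hr⟩ : ∃ r : ℝ, 0 < r ∧ ∀ s, r ≤ ‖g s‖ ∧ r ≤ ‖g s - 1‖ := by
    obtain ⟨s₀, -, hs₀⟩ := (isCompact_univ (X := unitInterval)).exists_isMinOn ⟨0, mem_univ _⟩
      (f := fun s => min ‖g s‖ ‖g s - 1‖) (by fun_prop)
    refine ⟨min ‖g s₀‖ ‖g s₀ - 1‖, ?_, fun s => ?_⟩
    · have h := (p.path s₀).2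
      exact lt_min (norm_pos_iff.2 h.1) (norm_pos_iff.2 (sub_ne_zero.2 h.2))
    · have h := hs₀ (mem_univ s)
      exact ⟨h.trans (min_le_left _ _), h.trans (min_le_right _ _)⟩
  obtain ⟨n, hn0, hn⟩ : ∃ n : ℕ, n ≠ 0 ∧ ‖bernsteinApproximation n g - g‖ < r := by
    have h := (tendsto_iff_norm_sub_tendsto_zero.1 (bernsteinApproximation_uniform g)).eventually
      (gt_mem_nhds hr0)
    obtain ⟨n, h1, h2⟩ := ((Filter.eventually_ne_atTop 0).and h).exists
    exact ⟨n, h1, h2⟩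
  have hb : ∀ s, ‖bernsteinApproximation n g s - g s‖ < r := fun s =>
    lt_of_le_of_lt ((bernsteinApproximation n g - g).norm_coe_le_norm s) hn
  have hne : ∀ (u s : unitInterval),
      g s + (u : ℝ) * (bernsteinApproximation n g s - g s) ≠ 0 ∧
      g s + (u : ℝ) * (bernsteinApproximation n g s - g s) ≠ 1 := by
    intro u s
    have h1 : ‖((u : ℝ) : ℂ) * (bernsteinApproximation n g s - g s)‖ < r := by
      rw [norm_mul, Complex.norm_real, Real.norm_eq_abs, abs_of_nonneg u.2.1]
      exact lt_of_le_of_lt (mul_le_of_le_one_left (norm_nonneg _) u.2.2) (hb s)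
    constructor
    · intro h
      have h2 : g s = -(((u : ℝ) : ℂ) * (bernsteinApproximation n g s - g s)) := by
        linear_combination h
      have h3 := (hr s).1
      rw [h2, norm_neg] at h3
      linarith
    · intro h
      have h2 : g s - 1 = -(((u : ℝ) : ℂ) * (bernsteinApproximation n g s - g s)) := by
        linear_combination h
      have h3 := (hr s).2
      rw [h2, norm_neg] at h3
      linarith
  have hg0 : g 0 = (tan01 p.source : ℂ) := congrArg Subtype.val p.path.source
  have hg1 : g 1 = (z : ℂ) := congrArg Subtype.val p.path.target
  let q : Path (tan01 p.source) (BasePoint.ofPoint z p.target) :=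
    { toFun := fun s => ⟨bernsteinApproximation n g s, by
        have h := hne 1 s
        simpa using h⟩
      continuous_toFun := by
        refine Continuous.subtype_mk (by fun_prop) _
      source' := by
        apply Subtype.ext
        simp [hg0]
      target' := by
        apply Subtype.ext
        simp [bernsteinApproximation.apply_one hn0, hg1] }
  have hpq : p.path.Homotopic q := ⟨
    { toFun := fun x => ⟨g x.2 + (x.1 : ℝ) * (bernsteinApproximation n g x.2 - g x.2), hne x.1 x.2⟩
      continuous_toFun := by
        refine Continuous.subtype_mk (by fun_prop) _
      map_zero_left := fun s => by
        apply Subtype.ext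
        simp [g]
      map_one_left := fun s => by
        apply Subtype.ext
        simp [q]
      prop' := fun u s hs => by
        apply Subtype.ext
        rcases hs with rfl | rfl
        · simp [g]
        · simp [bernsteinApproximation.apply_one hn0, g] }⟩
  refine ⟨⟨p.source, p.target, q⟩, ?_, ?_⟩
  · have hc : ContDiff ℝ 1 (fun s : ℝ => ∑ k : Fin (n + 1),
        ((n.choose k : ℝ) * s ^ (k : ℕ) * (1 - s) ^ (n - k)) •
          g (bernstein.z k)) := by
      fun_prop
    refine hc.contDiffOn.congr fun s hs => ?_
    rw [Path.extend_apply _ hs]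
    change bernsteinApproximation n g ⟨s, hs⟩ = _
    rw [bernsteinApproximation.apply]
    simp [bernstein_apply]
  · refine Quotient.sound (s := tangentialSetoid _ _) ?_
    refine (TangentialPath.homotopic_iff _ _).2 ⟨Path.refl _, Path.refl _, ?_⟩
    have hm : ∀ (e : BasePoint P1) (s : Germ),
        (Path.refl s).map e.continuous = Path.refl (e s) := fun e s => rfl
    simp only [hm, Path.Homotopic.Quotient.mk_refl, Path.Homotopic.Quotient.trans_refl,
      Path.Homotopic.Quotient.refl_trans]
    exact Path.Homotopic.Quotient.eq.2 hpq.symm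

/-- A continuously differentiable path in the given homotopy class.  The integrals below depend
only on the class and not on this choice. -/
noncomputable def smoothRep {z : P1} (γ : PathClass tan01 (BasePoint.ofPoint z)) :
    TangentialPath tan01 (BasePoint.ofPoint z) :=
  (exists_isC1 γ).choose

/-- The logarithm `log(z; γ)`: the integral of `dt/t` along the path that goes from `1` (tangential
base point `10`) back along the unit interval and then follows `γ`.  For the representative `p`
this is the integral from `1` to `p.source` along the real axis, followed by the integral along
`p.path`. -/
noncomputable def pathLog (z : P1) (γ : PathClass tan01 (BasePoint.ofPoint z)) : ℂ :=
  let p := smoothRep γ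
  (∫ u in (1 : ℝ)..(p.source : ℝ), (1 / u : ℂ)) +
    ∫ u in (p.source : ℝ)..(p.source + 1 : ℝ), deriv (fullPath p) u / fullPath p u

/-- The dilogarithm `Li₂(z; γ) = ∫_γ Li₁(t; γ_t) dt/t`, where `Li₁(z; γ) = ∫_γ dt/(1-t)`. -/
noncomputable def pathLi₂ (z : P1) (γ : PathClass tan01 (BasePoint.ofPoint z)) : ℂ :=
  let p := smoothRep γ
  li2Along (fullPath p) (p.source + 1)

end SpenceKummer

/-! The values `log(z; γ)` and `Li₂(z; γ)` are the end values of an analytic continuation. The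
triple `F = (log, Li₁, Li₂)` solves the system `F' = (1/z, 1/(1-z), Li₁/z)`, whose only
singularities in `ℂ` are `0` and `1`. Local solutions therefore continue uniquely along every path
in `ℂ ∖ {0, 1}`, and the end value depends only on the homotopy class (`Continuation.of_homotopic`).
For a continuously differentiable path it is given by the line integrals
(`Continuation.eq_integrals`), so `log` and `Li₂` may be computed by continuation along any
representative (`pathLog_pathLi₂_eq`).

This moves the problem to the complement of the arrangement. Continue the nine triples along `f₁ ∘
γ₀, …, f₉ ∘ γ₀`, starting with the branches produced by the paths `δᵢ`. The functions `1 - fᵢ`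
factor, up to sign, into powers of `y`, `1 - x`, `1 - y`, `x - y` and `1 - xy`, which gives additive
relations between the `Li₁(fᵢ)`, `log y` and `log f₆`: their combinations `logDefect` have
derivative zero (`hasDerivAt_logDefect`). Since `d Li₂(f) = Li₁(f) · d log f`, inserting these
relations makes the differentials of the three dilogarithm combinations cancel
(`hasDerivAt_dilogDefect`). So the equations, once true, stay true under continuation
(`functionalEquations_of_lift`).

The constants are found on the arc `(t², t)`. There the relations between logarithms are identities
of real logarithms (`logDefect_arc`), and the dilogarithm combinations are constant and equal to
their limits as `t → 0+` (`tendsto_dilogDefect_arc`). All arguments tend to `0` except `f₆ → 1`,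
which contributes `Li₂(1) = π²/6`, and `f₇ → -∞`, which is brought back to `0` by the inversion
formula (`dilog_inversion`). -/

section

open Set Filter Topology MeasureTheory
open scoped unitInterval

/-- Integration along rays: a holomorphic function on an open set that is star-shaped about `0`
has the primitive `z ↦ ∫₀¹ z g(tz) dt`. -/
theorem hasDerivAt_integral_ray {U : Set ℂ} {g : ℂ → ℂ} (hU : IsOpen U)
    (hstar : ∀ z ∈ U, ∀ t ∈ Icc (0 : ℝ) 1, (t : ℂ) * z ∈ U) (hg : DifferentiableOn ℂ g U)
    {z : ℂ} (hz : z ∈ U) :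
    HasDerivAt (fun w => ∫ t in (0 : ℝ)..1, w * g ((t : ℂ) * w)) (g z) z := by
  obtain ⟨r, hr, hrU⟩ := Metric.nhds_basis_closedBall.mem_iff.1 (hU.mem_nhds hz)
  have hg' : DifferentiableOn ℂ (deriv g) U := hg.deriv hU
  have hmaps : MapsTo (fun p : ℝ × ℂ => (p.1 : ℂ) * p.2)
      (Icc (0 : ℝ) 1 ×ˢ Metric.closedBall z r) U := fun p hp =>
    hstar _ (hrU hp.2) _ hp.1
  have hcont : ContinuousOn (fun p : ℝ × ℂ => (p.1 : ℂ) * p.2)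
      (Icc (0 : ℝ) 1 ×ˢ Metric.closedBall z r) := by fun_prop
  have hcF' : ContinuousOn (fun p : ℝ × ℂ => g ((p.1 : ℂ) * p.2) +
      p.2 * (deriv g ((p.1 : ℂ) * p.2) * p.1)) (Icc (0 : ℝ) 1 ×ˢ Metric.closedBall z r) := by
    have h1 := hg.continuousOn.comp hcont hmaps
    have h2 := hg'.continuousOn.comp hcont hmaps
    exact h1.add (continuousOn_snd.mul (h2.mul (by fun_prop)))
  have hcF : ContinuousOn (fun p : ℝ × ℂ => p.2 * g ((p.1 : ℂ) * p.2))
      (Icc (0 : ℝ) 1 ×ˢ Metric.closedBall z r) :=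
    continuousOn_snd.mul (hg.continuousOn.comp hcont hmaps)
  obtain ⟨C, hC⟩ := (isCompact_Icc.prod (isCompact_closedBall z r)).exists_bound_of_continuousOn hcF'
  have hI : uIoc (0 : ℝ) 1 ⊆ Icc 0 1 := by
    rw [uIoc_of_le zero_le_one]
    exact Ioc_subset_Icc_self
  have hslice : ∀ {f : ℝ × ℂ → ℂ}, ContinuousOn f (Icc (0 : ℝ) 1 ×ˢ Metric.closedBall z r) →
      ∀ w ∈ Metric.closedBall z r, ContinuousOn (fun t => f (t, w)) (Icc (0 : ℝ) 1) :=
    fun hf w hw => hf.comp (by fun_prop) fun t ht => ⟨ht, hw⟩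
  have hzr : z ∈ Metric.closedBall z r := Metric.mem_closedBall_self hr.le
  have hmeas : ∀ {f : ℝ → ℂ}, ContinuousOn f (Icc (0 : ℝ) 1) →
      AEStronglyMeasurable f (volume.restrict (uIoc (0 : ℝ) 1)) := fun hf =>
    (hf.mono hI).aestronglyMeasurable measurableSet_uIoc
  have key := (intervalIntegral.hasDerivAt_integral_of_dominated_loc_of_deriv_le (μ := volume)
    (a := (0 : ℝ)) (b := 1)
    (F := fun w t => w * g ((t : ℂ) * w))
    (F' := fun w t => g ((t : ℂ) * w) + w * (deriv g ((t : ℂ) * w) * t))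
    (bound := fun _ => C) (Metric.closedBall_mem_nhds z hr)
    (by
      filter_upwards [Metric.closedBall_mem_nhds z hr] with w hw
      exact hmeas (hslice hcF w hw))
    ((hslice hcF z hzr).intervalIntegrable_of_Icc zero_le_one)
    (hmeas (hslice hcF' z hzr))
    (Eventually.of_forall fun t ht w hw => hC (t, w) ⟨hI ht, hw⟩)
    intervalIntegrable_const
    (Eventually.of_forall fun t ht w hw => by
      have h1 : HasDerivAt g (deriv g ((t : ℂ) * w)) ((t : ℂ) * w) :=
        (hg.differentiableAt (hU.mem_nhds (hmaps (x := (t, w)) ⟨hI ht, hw⟩))).hasDerivAt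
      have h2 : HasDerivAt (fun w : ℂ => (t : ℂ) * w) t w := by
        simpa using (hasDerivAt_id w).const_mul (t : ℂ)
      have h3 := (hasDerivAt_id w).mul (h1.comp w h2)
      exact HasDerivAt.congr_deriv h3 (by simp))).2
  -- The differentiated integrand `g(tz) + tz g'(tz)` is the `t`-derivative of `t g(tz)`, so its
  -- integral over `[0, 1]` is `g(z)`.
  refine key.congr_deriv ?_
  have hd : ∀ t ∈ uIcc (0 : ℝ) 1, HasDerivAt (fun t : ℝ => (t : ℂ) * g ((t : ℂ) * z))
      (g ((t : ℂ) * z) + z * (deriv g ((t : ℂ) * z) * t)) t := by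
    intro t ht
    rw [uIcc_of_le zero_le_one] at ht
    have h1 : HasDerivAt g (deriv g ((t : ℂ) * z)) ((t : ℂ) * z) :=
      (hg.differentiableAt (hU.mem_nhds (hmaps (x := (t, z)) ⟨ht, hzr⟩))).hasDerivAt
    have h0 : HasDerivAt (fun t : ℝ => (t : ℂ)) 1 t := Complex.ofRealCLM.hasDerivAt
    have h2 : HasDerivAt (fun t : ℝ => (t : ℂ) * z) z t := by
      simpa using h0.mul_const z
    have h3 := h0.mul (h1.comp t h2)
    convert! h3 using 1
    simp
    ring
  have hint := intervalIntegral.integral_eq_sub_of_hasDerivAt hd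
    ((hslice hcF' z hzr).intervalIntegrable_of_Icc zero_le_one)
  rw [hint]
  simp

/-! ### The principal dilogarithm: power series, special values, inversion. -/

namespace SpenceKummer

/-- The integrand `-log(1-z)/z` of the dilogarithm, extended to `z = 0`. -/
noncomputable def dilogIntegrand : ℂ → ℂ := dslope (fun z => -Complex.log (1 - z)) 0

/-- The principal branch of the dilogarithm, on `ℂ ∖ [1, ∞)`. -/
noncomputable def dilog (z : ℂ) : ℂ := ∫ t in (0 : ℝ)..1, z * dilogIntegrand ((t : ℂ) * z)

theorem isOpen_one_sub_mem_slitPlane : IsOpen {z : ℂ | 1 - z ∈ Complex.slitPlane} :=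
  Complex.isOpen_slitPlane.preimage (by fun_prop)

theorem hasDerivAt_neg_log_one_sub {z : ℂ} (hz : 1 - z ∈ Complex.slitPlane) :
    HasDerivAt (fun z => -Complex.log (1 - z)) (1 / (1 - z)) z := by
  have h := (((hasDerivAt_id z).const_sub 1).clog hz).neg
  convert! h using 1
  simp [neg_div]

theorem differentiableOn_dilogIntegrand :
    DifferentiableOn ℂ dilogIntegrand {z : ℂ | 1 - z ∈ Complex.slitPlane} := by
  refine (Complex.differentiableOn_dslope
    (isOpen_one_sub_mem_slitPlane.mem_nhds (by simp))).2 fun z hz => ?_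
  exact (hasDerivAt_neg_log_one_sub hz).differentiableAt.differentiableWithinAt

theorem hasDerivAt_dilog' {z : ℂ} (hz : 1 - z ∈ Complex.slitPlane) :
    HasDerivAt dilog (dilogIntegrand z) z := by
  refine hasDerivAt_integral_ray isOpen_one_sub_mem_slitPlane (fun w hw t ht => ?_)
    differentiableOn_dilogIntegrand hz
  -- `1 - tw = (1 - t) · 1 + t (1 - w)`, and the slit plane is star-shaped about `1`.
  have h := Complex.starConvex_one_slitPlane hw (sub_nonneg.2 ht.2) ht.1 (by ring)
  simp only [mem_ofPred_eq]
  convert h using 1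
  simp
  ring

theorem dilogIntegrand_zero : dilogIntegrand 0 = 1 := by
  rw [dilogIntegrand, dslope_same]
  have h := hasDerivAt_neg_log_one_sub (z := 0) (by simp)
  simpa using h.deriv

theorem dilogIntegrand_of_ne {z : ℂ} (hz : z ≠ 0) :
    dilogIntegrand z = -Complex.log (1 - z) / z := by
  rw [dilogIntegrand, dslope_of_ne _ hz, slope_def_field]
  simp

theorem hasDerivAt_dilog {z : ℂ} (hz : 1 - z ∈ Complex.slitPlane) (h0 : z ≠ 0) :
    HasDerivAt dilog (-Complex.log (1 - z) / z) z :=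
  dilogIntegrand_of_ne h0 ▸ hasDerivAt_dilog' hz

@[simp]
theorem dilog_zero : dilog 0 = 0 := by simp [dilog]

theorem one_sub_mem_slitPlane_of_norm_lt_one {z : ℂ} (hz : ‖z‖ < 1) :
    1 - z ∈ Complex.slitPlane := by
  have := Complex.mem_slitPlane_of_norm_lt_one (z := -z) (by simpa using hz)
  simpa [sub_eq_add_neg] using this

theorem summable_one_div_succ_sq : Summable fun n : ℕ => 1 / ((n : ℝ) + 1) ^ 2 := by
  have h := (summable_nat_add_iff 1).2 (Real.summable_one_div_nat_pow.2 (one_lt_two))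
  simpa using h

theorem norm_dilog_term_le {z : ℂ} (hz : ‖z‖ ≤ 1) (n : ℕ) :
    ‖z ^ (n + 1) / ((n : ℂ) + 1) ^ 2‖ ≤ 1 / ((n : ℝ) + 1) ^ 2 := by
  rw [norm_div, norm_pow, norm_pow, show (n : ℂ) + 1 = ((n + 1 : ℕ) : ℂ) by push_cast; rfl,
    Complex.norm_natCast]
  push_cast
  gcongr
  exact pow_le_one₀ (norm_nonneg _) hz

/-- The bound `1/(n+1)²` is uniform on the closed disc. Including the boundary gives access to the
points `1` and `-1`, which the open disc of convergence misses. -/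
theorem continuousOn_dilogSeries :
    ContinuousOn (fun z : ℂ => ∑' n : ℕ, z ^ (n + 1) / ((n : ℂ) + 1) ^ 2)
      (Metric.closedBall 0 1) := by
  refine continuousOn_tsum (fun n => by fun_prop) summable_one_div_succ_sq fun n z hz => ?_
  exact norm_dilog_term_le (by simpa using hz) n

theorem hasDerivAt_dilogSeries {z : ℂ} (hz : ‖z‖ < 1) :
    HasDerivAt (fun z : ℂ => ∑' n : ℕ, z ^ (n + 1) / ((n : ℂ) + 1) ^ 2) (dilogIntegrand z) z := by
  -- The differentiated terms `zⁿ/(n+1)` are summable uniformly only on a smaller disc of radius `r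
  -- < 1`, where `rⁿ` dominates them.
  obtain ⟨r, hzr, hr1⟩ := exists_between hz
  have hr0 : 0 < r := (norm_nonneg z).trans_lt hzr
  have key : HasDerivAt (fun z : ℂ => ∑' n : ℕ, z ^ (n + 1) / ((n : ℂ) + 1) ^ 2)
      (∑' n : ℕ, z ^ n / ((n : ℂ) + 1)) z := by
    refine hasDerivAt_tsum_of_isPreconnected
      (g := fun (n : ℕ) (z : ℂ) => z ^ (n + 1) / ((n : ℂ) + 1) ^ 2)
      (g' := fun (n : ℕ) (z : ℂ) => z ^ n / ((n : ℂ) + 1)) (y₀ := 0)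
      (summable_geometric_of_lt_one hr0.le hr1)
      Metric.isOpen_ball (convex_ball (0 : ℂ) r).isPreconnected (fun n y _ => ?_) (fun n y hy => ?_)
      (Metric.mem_ball_self hr0) ?_ (by simpa using hzr)
    · have hn : (n : ℂ) + 1 ≠ 0 := by exact_mod_cast n.succ_ne_zero
      have h := (hasDerivAt_pow (n + 1) y).div_const (((n : ℂ) + 1) ^ 2)
      convert! h using 1
      push_cast
      field_simp
    · rw [norm_div, norm_pow, show (n : ℂ) + 1 = ((n + 1 : ℕ) : ℂ) by push_cast; rfl,
        Complex.norm_natCast]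
      refine (div_le_self (by positivity) (by exact_mod_cast n.succ_pos)).trans ?_
      exact pow_le_pow_left₀ (norm_nonneg _) (by simpa using (Metric.mem_ball.1 hy).le) n
    · simp [summable_zero]
  convert key using 1
  by_cases h0 : z = 0
  · subst h0
    rw [dilogIntegrand_zero, tsum_eq_single 0 fun n hn => by simp [hn]]
    simp
  · rw [dilogIntegrand_of_ne h0, ← (Complex.hasSum_taylorSeries_neg_log' hz).tsum_eq,
      ← tsum_div_const]
    refine tsum_congr fun n => ?_
    rw [pow_succ]
    field_simp

theorem dilog_eq_tsum {z : ℂ} (hz : ‖z‖ < 1) :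
    dilog z = ∑' n : ℕ, z ^ (n + 1) / ((n : ℂ) + 1) ^ 2 := by
  have hB : ∀ w ∈ Metric.ball (0 : ℂ) 1, ‖w‖ < 1 := fun w hw => by simpa using hw
  refine Metric.isOpen_ball.eqOn_of_deriv_eq (𝕜 := ℂ) (s := Metric.ball 0 1)
    (convex_ball (0 : ℂ) 1).isPreconnected
    (fun w hw => (hasDerivAt_dilog' (one_sub_mem_slitPlane_of_norm_lt_one
      (hB w hw))).differentiableAt.differentiableWithinAt)
    (fun w hw => (hasDerivAt_dilogSeries (hB w hw)).differentiableAt.differentiableWithinAt)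
    (fun w hw => ?_) (x := 0) (by simp) ?_ (by simpa using hz)
  · rw [(hasDerivAt_dilog' (one_sub_mem_slitPlane_of_norm_lt_one (hB w hw))).deriv,
      (hasDerivAt_dilogSeries (hB w hw)).deriv]
  · simp

theorem tsum_one_div_succ_sq : ∑' n : ℕ, (1 : ℂ) / ((n : ℂ) + 1) ^ 2 = (Real.pi : ℂ) ^ 2 / 6 := by
  have h := (hasSum_nat_add_iff' 1).2 hasSum_zeta_two
  have h2 := (Complex.hasSum_ofReal.2 h).tsum_eq
  push_cast at h2
  simpa using h2

/-- The point `1` lies on the cut, so `Li₂(1) = ζ(2)` is stated as a limit through `(0, 1)`,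
obtained from continuity of the series on the closed disc. -/
theorem tendsto_dilog_one :
    Tendsto (fun t : ℝ => dilog (t : ℂ)) (𝓝[<] 1) (𝓝 ((Real.pi : ℂ) ^ 2 / 6)) := by
  have h1 := continuousOn_dilogSeries 1 (by simp)
  have h2 : Tendsto (fun t : ℝ => (t : ℂ)) (𝓝[<] 1) (𝓝[Metric.closedBall 0 1] (1 : ℂ)) := by
    refine tendsto_nhdsWithin_iff.2 ⟨?_, ?_⟩
    · exact (Complex.continuous_ofReal.tendsto' 1 1 (by simp)).mono_left nhdsWithin_le_nhds
    · filter_upwards [Ioo_mem_nhdsLT (show (0 : ℝ) < 1 by norm_num)] with t ht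
      simp [abs_of_pos ht.1, ht.2.le]
  have h3 := h1.tendsto.comp h2
  have e : (∑' n : ℕ, (1 : ℂ) ^ (n + 1) / ((n : ℂ) + 1) ^ 2) = (Real.pi : ℂ) ^ 2 / 6 := by
    simpa using tsum_one_div_succ_sq
  rw [e] at h3
  refine h3.congr' ?_
  filter_upwards [Ioo_mem_nhdsLT (show (0 : ℝ) < 1 by norm_num)] with t ht
  exact (dilog_eq_tsum (by simp [abs_of_pos ht.1, ht.2])).symm

/-- Continuity extends the series to `-1`. The terms with even denominator add up to `ζ(2)/4`, those
with odd denominator to `-3ζ(2)/4`. -/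
theorem dilog_neg_one : dilog (-1) = -((Real.pi : ℂ) ^ 2 / 12) := by
  have hs : ∀ {z : ℂ}, ‖z‖ ≤ 1 → Summable fun n : ℕ => z ^ (n + 1) / ((n : ℂ) + 1) ^ 2 :=
    fun hz => summable_one_div_succ_sq.of_norm_bounded fun n => norm_dilog_term_le hz n
  have h1 : dilog (-1) = ∑' n : ℕ, (-1 : ℂ) ^ (n + 1) / ((n : ℂ) + 1) ^ 2 := by
    have hd : ContinuousAt dilog (-1) := (hasDerivAt_dilog' (by norm_num)).continuousAt
    have h2 : Tendsto (fun t : ℝ => -(t : ℂ)) (𝓝[<] 1) (𝓝[Metric.closedBall 0 1] (-1 : ℂ)) := by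
      refine tendsto_nhdsWithin_iff.2 ⟨?_, ?_⟩
      · exact (Complex.continuous_ofReal.neg.tendsto' 1 (-1) (by simp)).mono_left
          nhdsWithin_le_nhds
      · filter_upwards [Ioo_mem_nhdsLT (show (0 : ℝ) < 1 by norm_num)] with t ht
        simp [abs_of_pos ht.1, ht.2.le]
    have h3 := (continuousOn_dilogSeries (-1) (by simp)).tendsto.comp h2
    have h4 := hd.tendsto.comp (h2.mono_right nhdsWithin_le_nhds)
    refine tendsto_nhds_unique (h4.congr' ?_) h3
    filter_upwards [Ioo_mem_nhdsLT (show (0 : ℝ) < 1 by norm_num)] with t ht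
    exact dilog_eq_tsum (by simp [abs_of_pos ht.1, ht.2])
  have hodd : Summable fun n : ℕ => (1 : ℂ) / ((2 * n + 1 : ℂ) + 1) ^ 2 := by
    have := (hs (z := 1) (by simp)).comp_injective
      (i := fun n : ℕ => 2 * n + 1) (fun a b h => by simpa using h)
    simpa [Function.comp_def] using this
  have heven : Summable fun n : ℕ => (1 : ℂ) / ((2 * n : ℂ) + 1) ^ 2 := by
    have := (hs (z := 1) (by simp)).comp_injective
      (i := fun n : ℕ => 2 * n) (fun a b h => by simpa using h)
    simpa [Function.comp_def] using this
  have h2 := tsum_even_add_odd (f := fun n : ℕ => (1 : ℂ) / ((n : ℂ) + 1) ^ 2)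
    (by simpa using heven) (by simpa using hodd)
  have h3 := tsum_even_add_odd (f := fun n : ℕ => (-1 : ℂ) ^ (n + 1) / ((n : ℂ) + 1) ^ 2)
    (by simpa [pow_add, pow_mul, neg_div] using heven.neg)
    (by simpa [pow_add, pow_mul] using hodd)
  have h4 : ∑' n : ℕ, (1 : ℂ) / ((2 * n + 1 : ℂ) + 1) ^ 2 =
      1 / 4 * ∑' n : ℕ, (1 : ℂ) / ((n : ℂ) + 1) ^ 2 := by
    rw [← tsum_mul_left]
    refine tsum_congr fun n => ?_
    have hn : (n : ℂ) + 1 ≠ 0 := by exact_mod_cast n.succ_ne_zero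
    rw [show (2 * n + 1 : ℂ) + 1 = 2 * ((n : ℂ) + 1) by ring]
    field_simp
    norm_num
  have h5 : ∑' n : ℕ, (-1 : ℂ) ^ (2 * n + 1) / (((2 * n : ℕ) : ℂ) + 1) ^ 2 =
      -∑' n : ℕ, (1 : ℂ) / (((2 * n : ℕ) : ℂ) + 1) ^ 2 := by
    rw [← tsum_neg]
    refine tsum_congr fun n => ?_
    simp [pow_add, pow_mul, neg_div]
  have h6 : ∑' n : ℕ, (-1 : ℂ) ^ (2 * n + 1 + 1) / (((2 * n + 1 : ℕ) : ℂ) + 1) ^ 2 =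
      ∑' n : ℕ, (1 : ℂ) / (((2 * n + 1 : ℕ) : ℂ) + 1) ^ 2 := by
    refine tsum_congr fun n => ?_
    simp [pow_add, pow_mul]
  rw [h5, h6] at h3
  push_cast at h2 h3
  rw [h4, tsum_one_div_succ_sq] at h2 h3
  rw [h1, ← h3]
  linear_combination -h2

/-- The left side has derivative zero on `(0, ∞)`, because `log(1 + 1/r) = log(1 + r) - log r`. At
`r = 1` its value is `2 Li₂(-1)`. -/
theorem dilog_inversion {r : ℝ} (hr : 0 < r) :
    dilog (-(r : ℂ)) + dilog (-((r⁻¹ : ℝ) : ℂ)) + 1 / 2 * ((Real.log r : ℝ) : ℂ) ^ 2 =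
      -((Real.pi : ℂ) ^ 2 / 6) := by
  have hslit : ∀ {s : ℝ}, 0 < s → (1 : ℂ) - -(s : ℂ) ∈ Complex.slitPlane := fun {s} hs => by
    rw [Complex.mem_slitPlane_iff]
    left
    simp
    linarith
  have hlog : ∀ {s : ℝ}, 0 < s → Complex.log (1 - -(s : ℂ)) = ((Real.log (1 + s) : ℝ) : ℂ) :=
    fun {s} hs => by
    rw [Complex.ofReal_log (by linarith)]
    push_cast
    congr 1
    ring
  have hd : ∀ s ∈ Ioi (0 : ℝ), HasDerivAt (fun s : ℝ => dilog (-(s : ℂ)) +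
      dilog (-((s⁻¹ : ℝ) : ℂ)) + 1 / 2 * ((Real.log s : ℝ) : ℂ) ^ 2) 0 s := by
    intro s hs
    have hs : 0 < s := hs
    have hsi : 0 < s⁻¹ := inv_pos.2 hs
    have hsc : (s : ℂ) ≠ 0 := by exact_mod_cast hs.ne'
    have c1 : HasDerivAt (fun s : ℝ => -(s : ℂ)) (-1) s := Complex.ofRealCLM.hasDerivAt.neg
    have c2 : HasDerivAt (fun s : ℝ => -((s⁻¹ : ℝ) : ℂ)) (-((-(s ^ 2)⁻¹ : ℝ) : ℂ)) s :=
      (hasDerivAt_inv hs.ne').ofReal_comp.neg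
    have c3 := (Real.hasDerivAt_log hs.ne').ofReal_comp
    have d1 := (hasDerivAt_dilog (hslit hs) (neg_ne_zero.2 hsc)).comp s c1
    have d2 := (hasDerivAt_dilog (hslit hsi)
      (neg_ne_zero.2 (by exact_mod_cast hsi.ne'))).comp s c2
    have d3 := (c3.pow 2).const_mul (1 / 2 : ℂ)
    have d := (d1.add d2).add d3
    refine HasDerivAt.congr_deriv d ?_
    rw [hlog hs, hlog hsi, show 1 + s⁻¹ = (1 + s) / s by field_simp; ring,
      Real.log_div (by positivity) hs.ne']
    push_cast
    field_simp
    ring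
  have h := isOpen_Ioi.is_const_of_deriv_eq_zero (𝕜 := ℝ) (s := Ioi (0 : ℝ))
    (convex_Ioi (0 : ℝ)).isPreconnected
    (fun s hs => (hd s hs).differentiableAt.differentiableWithinAt)
    (fun s hs => (hd s hs).deriv) (x := r) (y := 1) hr (by simp)
  rw [h]
  norm_num
  rw [dilog_neg_one]
  ring

/-! ### Local solutions of the polylogarithm system. -/

/-- The function `F = (log, Li₁, Li₂)` is, on `W`, a solution of the differential equations of the
logarithm, of `Li₁`, and of the dilogarithm. -/
def IsPolylogSolution (F : ℂ → ℂ × ℂ × ℂ) (W : Set ℂ) : Prop :=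
  ∀ z ∈ W, HasDerivAt F (1 / z, 1 / (1 - z), (F z).2.1 / z) z

theorem IsPolylogSolution.mono {F : ℂ → ℂ × ℂ × ℂ} {W W' : Set ℂ} (h : IsPolylogSolution F W)
    (hW : W' ⊆ W) : IsPolylogSolution F W' := fun z hz => h z (hW hz)

theorem IsPolylogSolution.continuousOn {F : ℂ → ℂ × ℂ × ℂ} {W : Set ℂ}
    (h : IsPolylogSolution F W) : ContinuousOn F W :=
  fun z hz => (h z hz).continuousAt.continuousWithinAt

/-- The system is triangular: the first two derivatives do not involve the solution, and the third
involves only the second component, so the components can be compared one after the other. -/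
theorem IsPolylogSolution.eqOn {F G : ℂ → ℂ × ℂ × ℂ} {W : Set ℂ} (hF : IsPolylogSolution F W)
    (hG : IsPolylogSolution G W) (hW : IsOpen W) (hc : IsPreconnected W) {z : ℂ} (hz : z ∈ W)
    (h : F z = G z) : EqOn F G W := by
  have hF1 := fun w hw => (hF w hw).fst
  have hF2 := fun w hw => (hF w hw).snd.fst
  have hF3 := fun w hw => (hF w hw).snd.snd
  have hG1 := fun w hw => (hG w hw).fst
  have hG2 := fun w hw => (hG w hw).snd.fst
  have hG3 := fun w hw => (hG w hw).snd.snd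
  have aux : ∀ {f g f' g' : ℂ → ℂ}, (∀ w ∈ W, HasDerivAt f (f' w) w) →
      (∀ w ∈ W, HasDerivAt g (g' w) w) → EqOn f' g' W → f z = g z → EqOn f g W := by
    intro f g f' g' hf hg hfg h0
    refine hW.eqOn_of_deriv_eq hc (fun w hw => (hf w hw).differentiableAt.differentiableWithinAt)
      (fun w hw => (hg w hw).differentiableAt.differentiableWithinAt) (fun w hw => ?_) hz h0
    rw [(hf w hw).deriv, (hg w hw).deriv, hfg hw]
  have e1 := aux hF1 hG1 (fun w _ => rfl) (congrArg Prod.fst h)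
  have e2 := aux hF2 hG2 (fun w _ => rfl) (congrArg (fun v => v.2.1) h)
  have e3 := aux hF3 hG3 (fun w hw => by simpa using congrArg (· / w) (e2 hw))
    (congrArg (fun v => v.2.2) h)
  exact fun w hw => Prod.ext (e1 hw) (Prod.ext (e2 hw) (e3 hw))

/-- The distance from `z` to the set `{0, 1}`. -/
noncomputable def punctureDist (z : ℂ) : ℝ := min ‖z‖ ‖1 - z‖

theorem punctureDist_pos {z : ℂ} (h : z ≠ 0 ∧ z ≠ 1) : 0 < punctureDist z :=
  lt_min (norm_pos_iff.2 h.1) (norm_pos_iff.2 (sub_ne_zero.2 h.2.symm))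

/-- On the largest disc about `z₀` avoiding `0` and `1`, both `z / z₀` and `(1 - z) / (1 - z₀)` stay
within distance less than `1` of `1`, where the principal logarithm is holomorphic. The third
component is a primitive on the disc. -/
theorem exists_isPolylogSolution {z₀ : ℂ} (h : z₀ ≠ 0 ∧ z₀ ≠ 1) (v : ℂ × ℂ × ℂ) :
    ∃ F, IsPolylogSolution F (Metric.ball z₀ (punctureDist z₀)) ∧ F z₀ = v := by
  obtain ⟨h0, h1⟩ := h
  have h1' : 1 - z₀ ≠ 0 := sub_ne_zero.2 h1.symm
  have hd : ∀ z ∈ Metric.ball z₀ (punctureDist z₀),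
      z ≠ 0 ∧ 1 - z ≠ 0 ∧ z / z₀ ∈ Complex.slitPlane ∧ (1 - z) / (1 - z₀) ∈ Complex.slitPlane := by
    intro z hz
    rw [Metric.mem_ball, dist_eq_norm] at hz
    have hz0 : ‖z - z₀‖ < ‖z₀‖ := hz.trans_le (min_le_left _ _)
    have hz1 : ‖z - z₀‖ < ‖1 - z₀‖ := hz.trans_le (min_le_right _ _)
    have a1 : z / z₀ ∈ Complex.slitPlane := by
      have := Complex.mem_slitPlane_of_norm_lt_one (z := (z - z₀) / z₀)
        (by rwa [norm_div, div_lt_one (norm_pos_iff.2 h0)])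
      convert this using 1
      field_simp
      ring
    have a2 : (1 - z) / (1 - z₀) ∈ Complex.slitPlane := by
      have := Complex.mem_slitPlane_of_norm_lt_one (z := -(z - z₀) / (1 - z₀))
        (by rwa [norm_div, norm_neg, div_lt_one (norm_pos_iff.2 h1')])
      convert this using 1
      field_simp
      ring
    refine ⟨fun e => ?_, fun e => ?_, a1, a2⟩
    · simp [e] at a1
    · simp [e] at a2
  let b : ℂ → ℂ := fun z => v.2.1 - Complex.log ((1 - z) / (1 - z₀))
  have hb : ∀ z ∈ Metric.ball z₀ (punctureDist z₀), HasDerivAt b (1 / (1 - z)) z := by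
    intro z hz
    obtain ⟨d0, d1, d2, d3⟩ := hd z hz
    have := ((((hasDerivAt_id z).const_sub 1).div_const (1 - z₀)).clog d3).const_sub v.2.1
    refine HasDerivAt.congr_deriv this ?_
    simp only [id_eq]
    field_simp
  have hbd : DifferentiableOn ℂ (fun z => b z / z) (Metric.ball z₀ (punctureDist z₀)) :=
    fun z hz => ((hb z hz).differentiableAt.div differentiableAt_id
      (hd z hz).1).differentiableWithinAt
  obtain ⟨c, hc0, hc⟩ := (hbd.isExactOn_ball).with_val_at z₀ v.2.2
  refine ⟨fun z => (v.1 + Complex.log (z / z₀), b z, c z), fun z hz => ?_, ?_⟩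
  · obtain ⟨d0, d1, d2, d3⟩ := hd z hz
    refine HasDerivAt.prodMk ?_ ((hb z hz).prodMk (hc z hz))
    have := (((hasDerivAt_id z).div_const z₀).clog d2).const_add v.1
    refine HasDerivAt.congr_deriv this ?_
    simp only [id_eq]
    field_simp
  · simp [b, hc0, h0, h1']

/-! ### Lifts of the solutions along continuous maps. -/

section Lift

variable {S T : Type*} [TopologicalSpace S] [TopologicalSpace T]

/-- `L` is a continuous determination of `(log, Li₁, Li₂)` along the map `h`. -/
def IsPolylogLift (h : S → ℂ) (L : S → ℂ × ℂ × ℂ) : Prop :=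
  ∀ s, ∃ F : ℂ → ℂ × ℂ × ℂ, ∃ W, IsOpen W ∧ h s ∈ W ∧ IsPolylogSolution F W ∧
    ∀ᶠ s' in 𝓝 s, L s' = F (h s')

theorem IsPolylogLift.comp {h : S → ℂ} {L : S → ℂ × ℂ × ℂ} (hL : IsPolylogLift h L) {g : T → S}
    (hg : Continuous g) : IsPolylogLift (h ∘ g) (L ∘ g) := fun t => by
  obtain ⟨F, W, hW, hm, hF, he⟩ := hL (g t)
  exact ⟨F, W, hW, hm, hF, hg.continuousAt.eventually he⟩

theorem IsPolylogSolution.isPolylogLift {F : ℂ → ℂ × ℂ × ℂ} {W : Set ℂ}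
    (hF : IsPolylogSolution F W) (hW : IsOpen W) {h : S → ℂ} (hm : ∀ s, h s ∈ W) :
    IsPolylogLift h (F ∘ h) :=
  fun s => ⟨F, W, hW, hm s, hF, Eventually.of_forall fun _ => rfl⟩

theorem isPolylogLift_const {z : ℂ} (hz : z ≠ 0 ∧ z ≠ 1) (v : ℂ × ℂ × ℂ) :
    IsPolylogLift (fun _ : S => z) fun _ => v := fun s => by
  obtain ⟨F, hF, hv⟩ := exists_isPolylogSolution hz v
  exact ⟨F, _, Metric.isOpen_ball, Metric.mem_ball_self (punctureDist_pos hz), hF,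
    Eventually.of_forall fun _ => hv.symm⟩

theorem IsPolylogLift.continuous {h : S → ℂ} {L : S → ℂ × ℂ × ℂ} (hL : IsPolylogLift h L)
    (hh : Continuous h) : Continuous L := by
  refine continuous_iff_continuousAt.2 fun s => ?_
  obtain ⟨F, W, hW, hm, hF, he⟩ := hL s
  have h1 : ContinuousAt (F ∘ h) s := (hF _ hm).continuousAt.comp hh.continuousAt
  exact h1.congr (he.mono fun _ e => e.symm)

/-- By uniqueness on a small disc, the solution witnessing the lift near `s` can be exchanged for
any other solution with the right value at `h s`. -/
theorem IsPolylogLift.eventually_eq {h : S → ℂ} {L : S → ℂ × ℂ × ℂ} (hL : IsPolylogLift h L)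
    (hh : Continuous h) {G : ℂ → ℂ × ℂ × ℂ} {V : Set ℂ} (hG : IsPolylogSolution G V)
    (hV : IsOpen V) {s : S} (hs : h s ∈ V) (e : L s = G (h s)) :
    ∀ᶠ s' in 𝓝 s, L s' = G (h s') := by
  obtain ⟨F, W, hW, hm, hF, he⟩ := hL s
  obtain ⟨r, hr, hrW⟩ := Metric.isOpen_iff.1 (hW.inter hV) _ ⟨hm, hs⟩
  have hFG : EqOn F G (Metric.ball (h s) r) :=
    (hF.mono (hrW.trans inter_subset_left)).eqOn (hG.mono (hrW.trans inter_subset_right))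
      Metric.isOpen_ball (convex_ball _ _).isPreconnected (Metric.mem_ball_self hr)
      (he.self_of_nhds.symm.trans e)
  filter_upwards [he, hh.continuousAt.eventually (Metric.ball_mem_nhds _ hr)] with s' h1 h2
  rw [h1, hFG h2]

/-- The set where the two lifts agree is closed by continuity and open by local uniqueness. -/
theorem IsPolylogLift.eq [PreconnectedSpace S] {h : S → ℂ} {L L' : S → ℂ × ℂ × ℂ}
    (hL : IsPolylogLift h L) (hL' : IsPolylogLift h L') (hh : Continuous h) {s₀ : S}
    (h0 : L s₀ = L' s₀) : L = L' := by
  have hcl : IsClopen {s | L s = L' s} := by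
    refine ⟨isClosed_eq (hL.continuous hh) (hL'.continuous hh), isOpen_iff_mem_nhds.2 fun s hs => ?_⟩
    obtain ⟨F, W, hW, hm, hF, he⟩ := hL' s
    have h1 : L s = L' s := hs
    filter_upwards [he, hL.eventually_eq hh hF hW hm (h1.trans he.self_of_nhds)] with s' e1 e2
    exact e2.trans e1.symm
  have := hcl.eq_univ ⟨s₀, h0⟩
  funext s
  have hs : s ∈ {s | L s = L' s} := this ▸ mem_univ s
  exact hs

/-- If `h' s` stays in the disc about `h s` that avoids `0` and `1`, the lift can be transported to
`h'` by evaluating at `h' s` the solution that `L` determines on this disc. -/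
theorem IsPolylogLift.perturb {h h' : S → ℂ} {L : S → ℂ × ℂ × ℂ} (hL : IsPolylogLift h L)
    (hh : Continuous h) (hh' : Continuous h') (hp : ∀ s, h s ≠ 0 ∧ h s ≠ 1)
    (hd : ∀ s, dist (h' s) (h s) < punctureDist (h s)) :
    ∃ L', IsPolylogLift h' L' ∧ ∀ s, h' s = h s → L' s = L s := by
  choose F hF hFv using fun s => exists_isPolylogSolution (hp s) (L s)
  refine ⟨fun s => F s (h' s), fun s => ⟨F s, _, Metric.isOpen_ball, hd s, hF s, ?_⟩,
    fun s hs => by simp only [hs, hFv]⟩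
  have hm : h s ∈ Metric.ball (h s) (punctureDist (h s)) :=
    Metric.mem_ball_self (punctureDist_pos (hp s))
  filter_upwards [hL.eventually_eq hh (hF s) Metric.isOpen_ball hm (hFv s).symm,
    hh.continuousAt.eventually (Metric.isOpen_ball.mem_nhds hm),
    hh'.continuousAt.eventually (Metric.isOpen_ball.mem_nhds (hd s))] with s' e1 e2 e3
  -- The solutions centred at `h s'` and `h s` agree at `h s'`, hence on the intersection of their
  -- discs, which is convex and contains `h' s'`.
  exact ((hF s').mono inter_subset_left).eqOn ((hF s).mono inter_subset_right)
    (Metric.isOpen_ball.inter Metric.isOpen_ball)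
    ((convex_ball _ _).inter (convex_ball _ _)).isPreconnected
    ⟨Metric.mem_ball_self (punctureDist_pos (hp s')), e2⟩ ((hFv s').trans e1) ⟨hd s', e3⟩

end Lift

theorem continuous_punctureDist : Continuous punctureDist := by
  unfold punctureDist
  fun_prop

/-- Lifts exist along maps on the unit square. -/
theorem exists_isPolylogLift_square {h : I × I → ℂ} (hh : Continuous h)
    (hp : ∀ s, h s ≠ 0 ∧ h s ≠ 1) (v : ℂ × ℂ × ℂ) : ∃ L, IsPolylogLift h L ∧ L (0, 0) = v := by
  obtain ⟨s₀, -, hs₀⟩ := (isCompact_univ (X := I × I)).exists_isMinOn ⟨(0, 0), mem_univ _⟩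
    (f := fun s => punctureDist (h s)) (continuous_punctureDist.comp hh).continuousOn
  set r := punctureDist (h s₀) with hr
  have hr0 : 0 < r := punctureDist_pos (hp s₀)
  have hrs : ∀ s, r ≤ punctureDist (h s) := fun s => hs₀ (mem_univ s)
  -- Contract the square to its corner: `H 0` is constant and `H 1 = h`. The bound `r` on the
  -- distance to `{0, 1}` is the same for all `H t`, so the set `P` of parameters admitting a lift
  -- is open and closed.
  let H : C(I, C(I × I, ℂ)) := ContinuousMap.curry
    ⟨fun p => h (p.1 * p.2.1, p.1 * p.2.2), by fun_prop⟩
  have hHp : ∀ t s, H t s ≠ 0 ∧ H t s ≠ 1 := fun t s => hp _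
  have hHr : ∀ t s, r ≤ punctureDist (H t s) := fun t s => hrs _
  have hH0 : ∀ t, H t (0, 0) = h (0, 0) := fun t => by simp [H]
  let P : Set I := {t | ∃ L, IsPolylogLift (H t) L ∧ L (0, 0) = v}
  have step : ∀ t t', dist (H t') (H t) < r → t ∈ P → t' ∈ P := by
    rintro t t' hd ⟨L, hL, hv⟩
    obtain ⟨L', hL', he⟩ := hL.perturb (H t).continuous (H t').continuous (hHp t)
      fun s => ((ContinuousMap.dist_apply_le_dist s).trans_lt hd).trans_le (hHr t s)
    exact ⟨L', hL', by rw [he _ (by rw [hH0, hH0]), hv]⟩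
  have hnear : ∀ t, ∀ᶠ t' in 𝓝 t, dist (H t') (H t) < r := fun t =>
    H.continuous.continuousAt.eventually (Metric.ball_mem_nhds _ hr0)
  have hcl : IsClopen P := by
    refine ⟨isOpen_compl_iff.1 (isOpen_iff_mem_nhds.2 fun t ht => ?_),
      isOpen_iff_mem_nhds.2 fun t ht => ?_⟩
    · filter_upwards [hnear t] with t' h1 h2
      exact ht (step t' t (by rwa [dist_comm]) h2)
    · filter_upwards [hnear t] with t' h1
      exact step t t' h1 ht
  have h0 : (0 : I) ∈ P := by
    refine ⟨fun _ => v, ?_, rfl⟩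
    have : ⇑(H 0) = fun _ => h (0, 0) := by
      funext s
      simp [H]
    rw [this]
    exact isPolylogLift_const (hp _) v
  have h1 : (1 : I) ∈ P := hcl.eq_univ ⟨0, h0⟩ ▸ mem_univ _
  obtain ⟨L, hL, hv⟩ := h1
  refine ⟨L, ?_, hv⟩
  have : ⇑(H 1) = h := by
    funext s
    simp [H]
  rwa [this] at hL

theorem exists_isPolylogLift {h : I → ℂ} (hh : Continuous h)
    (hp : ∀ s, h s ≠ 0 ∧ h s ≠ 1) (v : ℂ × ℂ × ℂ) : ∃ L, IsPolylogLift h L ∧ L 0 = v := by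
  obtain ⟨L, hL, hv⟩ := exists_isPolylogLift_square (h := h ∘ Prod.fst) (by fun_prop)
    (fun s => hp s.1) v
  exact ⟨_, hL.comp (g := fun t : I => (t, 0)) (by fun_prop), hv⟩

/-! ### Analytic continuation along paths and homotopy invariance. -/

/-- Analytic continuation of `(log, Li₁, Li₂)` along `q` leads from the value `v` to `w`. -/
def Continuation {a b : P1} (q : Path a b) (v w : ℂ × ℂ × ℂ) : Prop :=
  ∃ L, IsPolylogLift (fun t => (q t : ℂ)) L ∧ L 0 = v ∧ L 1 = w

section Continuation

variable {a b c : P1} {v w u : ℂ × ℂ × ℂ}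

theorem exists_continuation (q : Path a b) (v : ℂ × ℂ × ℂ) : ∃ w, Continuation q v w := by
  obtain ⟨L, hL, hv⟩ := exists_isPolylogLift (h := fun t => (q t : ℂ)) (by fun_prop)
    (fun t => (q t).2) v
  exact ⟨_, L, hL, hv, rfl⟩

theorem Continuation.apply_one_eq {q : Path a b} (h : Continuation q v w) {L : I → ℂ × ℂ × ℂ}
    (hL : IsPolylogLift (fun t => (q t : ℂ)) L) (h0 : L 0 = v) : L 1 = w := by
  obtain ⟨L', hL', h0', rfl⟩ := h
  rw [hL.eq hL' (by fun_prop) (h0.trans h0'.symm)]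

theorem Continuation.eq {q : Path a b} (h : Continuation q v w) (h' : Continuation q v u) :
    w = u := by
  obtain ⟨L', hL', h0', rfl⟩ := h
  exact h'.apply_one_eq hL' h0'

/-- A lift along the concatenation restricts to lifts along both halves, and these are determined by
their initial values. -/
theorem Continuation.trans {q : Path a b} {q' : Path b c} (h : Continuation q v w)
    (h' : Continuation q' w u) : Continuation (q.trans q') v u := by
  obtain ⟨x, hx⟩ := exists_continuation (q.trans q') v
  obtain ⟨L, hL, h0, h1⟩ := id hx
  let g₁ : I → I := fun t => ⟨(t : ℝ) / 2, by have := t.2.1; positivity, by linarith [t.2.2]⟩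
  let g₂ : I → I := fun t => ⟨(1 + (t : ℝ)) / 2, by have := t.2.1; positivity, by linarith [t.2.2]⟩
  have hg₁ : Continuous g₁ := by
    refine Continuous.subtype_mk (by fun_prop) _
  have hg₂ : Continuous g₂ := by
    refine Continuous.subtype_mk (by fun_prop) _
  have e₁ : (fun t => ((q.trans q') t : ℂ)) ∘ g₁ = fun t => (q t : ℂ) := by
    funext t
    have : (q.trans q') (g₁ t) = q t := by
      rw [Path.trans_apply, dif_pos (by simp only [g₁]; linarith [t.2.2])]
      congr 1
      ext
      simp only [g₁]
      ring
    simp [this]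
  have e₂ : (fun t => ((q.trans q') t : ℂ)) ∘ g₂ = fun t => (q' t : ℂ) := by
    funext t
    have : (q.trans q') (g₂ t) = q' t := by
      by_cases ht : (t : ℝ) = 0
      · obtain rfl : t = 0 := Subtype.ext ht
        rw [Path.trans_apply, dif_pos (by simp [g₂])]
        simp [g₂]
      · have ht' : 0 < (t : ℝ) := lt_of_le_of_ne t.2.1 (Ne.symm ht)
        rw [Path.trans_apply, dif_neg (by simp only [g₂]; linarith)]
        congr 1
        ext
        simp only [g₂]
        ring
    simp [this]
  have h2 := hL.comp hg₁
  have h3 := hL.comp hg₂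
  rw [e₁] at h2
  rw [e₂] at h3
  have h4 : L (g₁ 1) = w := h.apply_one_eq h2 (by simp [g₁, ← h0])
  have h5 : L (g₂ 1) = u := h'.apply_one_eq h3 (by
    rw [← h4]
    simp [g₁, g₂])
  have h6 : x = u := by
    rw [← h1, ← h5]
    congr 1
    ext
    simp [g₂]
  exact h6 ▸ hx

theorem continuation_of_constant {q : Path a b} (hq : ∀ t, q t = a) (v : ℂ × ℂ × ℂ) :
    Continuation q v v := by
  refine ⟨fun _ => v, ?_, rfl, rfl⟩
  simp only [hq]
  exact isPolylogLift_const a.2 v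

theorem IsPolylogSolution.continuation {F : ℂ → ℂ × ℂ × ℂ} {W : Set ℂ}
    (hF : IsPolylogSolution F W) (hW : IsOpen W) {q : Path a b} (hq : ∀ t, (q t : ℂ) ∈ W) :
    Continuation q (F a) (F b) :=
  ⟨_, hF.isPolylogLift hW hq, by simp, by simp⟩

/-- Lift the whole homotopy. On the two sides of the square where the homotopy sits at a fixed
endpoint, the lift is constant by uniqueness, so the lifts along `q` and `q'` have equal end values.
-/
theorem Continuation.of_homotopic {q q' : Path a b} (hqq' : q.Homotopic q')
    (h : Continuation q v w) : Continuation q' v w := by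
  obtain ⟨H⟩ := hqq'
  obtain ⟨L, hL, h0⟩ := exists_isPolylogLift_square (h := fun s => (H s : ℂ)) (by fun_prop)
    (fun s => (H s).2) v
  have hedge : ∀ (x : I) (z : P1), (∀ t, H (t, x) = z) → L (1, x) = L (0, x) := by
    intro x z hx
    have h1 := hL.comp (g := fun t : I => (t, x)) (by fun_prop)
    have h2 : (fun s => (H s : ℂ)) ∘ (fun t : I => (t, x)) = fun _ => (z : ℂ) := by
      funext t
      simp [hx]
    rw [h2] at h1
    have h3 := h1.eq (isPolylogLift_const z.2 (L (0, x))) continuous_const (s₀ := 0) rfl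
    exact congrFun h3 1
  have hbot := hL.comp (g := fun x : I => ((0 : I), x)) (by fun_prop)
  have htop := hL.comp (g := fun x : I => ((1 : I), x)) (by fun_prop)
  have e0 : (fun s => (H s : ℂ)) ∘ (fun x : I => ((0 : I), x)) = fun x => (q x : ℂ) := by
    funext x
    simp
  have e1 : (fun s => (H s : ℂ)) ∘ (fun x : I => ((1 : I), x)) = fun x => (q' x : ℂ) := by
    funext x
    simp
  rw [e0] at hbot
  rw [e1] at htop
  refine ⟨_, htop, ?_, ?_⟩
  · exact (hedge 0 a fun t => by simp).trans h0
  · exact (hedge 1 b fun t => by simp).trans (h.apply_one_eq hbot h0)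

end Continuation

/-! ### The principal determination and the values of the line integrals -/

/-- The principal determination of `(log, Li₁, Li₂)`. -/
noncomputable def principalPolylog (z : ℂ) : ℂ × ℂ × ℂ :=
  (Complex.log z, -Complex.log (1 - z), dilog z)

/-- The plane cut along `(-∞, 0]` and `[1, ∞)`. -/
def doublySlitPlane : Set ℂ := {z | z ∈ Complex.slitPlane ∧ 1 - z ∈ Complex.slitPlane}

theorem isOpen_doublySlitPlane : IsOpen doublySlitPlane :=
  Complex.isOpen_slitPlane.inter isOpen_one_sub_mem_slitPlane

theorem isPolylogSolution_principalPolylog :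
    IsPolylogSolution principalPolylog doublySlitPlane := by
  rintro z ⟨h0, h1⟩
  have hl := Complex.hasDerivAt_log h0
  rw [← one_div] at hl
  exact hl.prodMk ((hasDerivAt_neg_log_one_sub h1).prodMk
    (hasDerivAt_dilog h1 (Complex.slitPlane_ne_zero h0)))

theorem ofReal_mem_doublySlitPlane {r : ℝ} (h0 : 0 < r) (h1 : r < 1) :
    (r : ℂ) ∈ doublySlitPlane := by
  refine ⟨Complex.ofReal_mem_slitPlane.2 h0, ?_⟩
  have := Complex.ofReal_mem_slitPlane.2 (sub_pos.2 h1)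
  simpa using this

/-- The endpoint of the continuation of the principal determination along a path from the
tangential base point `01` is an invariant of the homotopy class. -/
theorem Continuation.of_tangential_homotopic {z : P1}
    {p q : TangentialPath tan01 (BasePoint.ofPoint z)} (hpq : p.Homotopic q) {w : ℂ × ℂ × ℂ}
    (h : Continuation p.path (principalPolylog (p.source : ℝ)) w) :
    Continuation q.path (principalPolylog (q.source : ℝ)) w := by
  obtain ⟨ρ, τ, hst⟩ := hpq
  obtain ⟨w', hw'⟩ := exists_continuation q.path (principalPolylog (q.source : ℝ))
  -- The target is an ordinary point, so moving the cut point there gives a constant path. At the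
  -- source the cut point moves inside `(0, 1)`, where the continuation just follows the principal
  -- determination.
  have h1 := (h.trans (continuation_of_constant (q := τ.map (BasePoint.ofPoint z).continuous)
    (fun _ => rfl) w)).of_homotopic hst
  have h2 : Continuation (ρ.map tan01.continuous) (principalPolylog (p.source : ℝ))
      (principalPolylog (q.source : ℝ)) :=
    isPolylogSolution_principalPolylog.continuation isOpen_doublySlitPlane
      fun t => ofReal_mem_doublySlitPlane (ρ t).2.1 (ρ t).2.2
  exact h1.eq (h2.trans hw') ▸ hw'

/-- The derivative of `fullPath` is not controlled at the ends of a piece or at the corner where the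
real segment meets `p.path`. Only interior derivatives are required, and integrability comes from a
continuous `g` that agrees with `f'` inside. -/
theorem integral_eq_sub_of_hasDerivAt_Ioo {f f' g : ℝ → ℂ} {a b : ℝ} (hab : a ≤ b)
    (hf : ContinuousOn f (Icc a b)) (hd : ∀ x ∈ Ioo a b, HasDerivAt f (f' x) x)
    (hg : ContinuousOn g (Icc a b)) (hfg : EqOn g f' (Ioo a b)) :
    ∫ x in a..b, f' x = f b - f a :=
  intervalIntegral.integral_eq_sub_of_hasDerivAt_of_le hab hf hd
    ((hg.intervalIntegrable_of_Icc hab).congr_uIoo (by rwa [uIoo_of_le hab]))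

/-! ### Line integrals along the real initial segment and along a continuously differentiable path.
-/

section FullPath

variable {z : P1} (p : TangentialPath tan01 (BasePoint.ofPoint z))

theorem fullPath_eq_extend {s : ℝ} (hs : (p.source : ℝ) ≤ s) :
    fullPath p s = p.path.extend (s - (p.source : ℝ)) := by
  rcases hs.eq_or_lt with h | h
  · simp only [fullPath, ← h, le_refl, if_true, sub_self, Path.extend_zero]
    rfl
  · exact if_neg h.not_ge

theorem fullPath_eq_id {s : ℝ} (hs : s ≤ (p.source : ℝ)) : fullPath p s = s := if_pos hs

theorem hasDerivAt_fullPath_initial {s : ℝ} (hs : s < (p.source : ℝ)) :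
    HasDerivAt (fullPath p) 1 s := by
  refine Complex.ofRealCLM.hasDerivAt.congr_of_eventuallyEq ?_
  filter_upwards [Iio_mem_nhds hs] with t ht
  exact fullPath_eq_id p (le_of_lt ht)

theorem li1Along_initial {s : ℝ} (h0 : 0 ≤ s) (hs : s ≤ (p.source : ℝ)) :
    li1Along (fullPath p) s = -Complex.log (1 - s) := by
  have h1 : s < 1 := hs.trans_lt p.source.2.2
  have hm : ∀ u ∈ Icc 0 s, (1 : ℂ) - u ∈ Complex.slitPlane := fun u hu => by
    have := Complex.ofReal_mem_slitPlane.2 (sub_pos.2 (hu.2.trans_lt h1))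
    simpa using this
  have hd : ∀ u ∈ Icc 0 s, HasDerivAt (fun u : ℝ => -Complex.log (1 - u)) (1 / (1 - u)) u :=
    fun u hu => by
    have := (hasDerivAt_neg_log_one_sub (hm u hu)).comp u Complex.ofRealCLM.hasDerivAt
    exact HasDerivAt.congr_deriv this (by simp)
  have e : ∀ u ∈ Ioo 0 s, deriv (fullPath p) u / (1 - fullPath p u) = 1 / (1 - (u : ℂ)) :=
    fun u hu => by
    rw [(hasDerivAt_fullPath_initial p (hu.2.trans_le hs)).deriv,
      fullPath_eq_id p (hu.2.le.trans hs)]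
  have hg : ContinuousOn (fun u : ℝ => 1 / (1 - (u : ℂ))) (Icc 0 s) :=
    continuousOn_const.div (by fun_prop) fun u hu => Complex.slitPlane_ne_zero (hm u hu)
  rw [li1Along, intervalIntegral.integral_congr_Ioo_of_le h0 e,
    integral_eq_sub_of_hasDerivAt_Ioo h0 (fun u hu => (hd u hu).continuousAt.continuousWithinAt)
      (fun u hu => hd u ⟨hu.1.le, hu.2.le⟩) hg fun u _ => rfl]
  simp

theorem li1Along_integrand_intervalIntegrable :
    IntervalIntegrable (fun u => deriv (fullPath p) u / (1 - fullPath p u)) volume 0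
      (p.source : ℝ) := by
  have hg : ContinuousOn (fun u : ℝ => 1 / (1 - (u : ℂ))) (Icc 0 (p.source : ℝ)) :=
    continuousOn_const.div (by fun_prop) fun u hu => by
      have h : (1 : ℝ) - u ≠ 0 := (sub_pos.2 (hu.2.trans_lt p.source.2.2)).ne'
      exact_mod_cast h
  refine (hg.intervalIntegrable_of_Icc p.source.2.1.le).congr_uIoo ?_
  rw [uIoo_of_le p.source.2.1.le]
  intro u hu
  simp only
  rw [(hasDerivAt_fullPath_initial p hu.2).deriv, fullPath_eq_id p hu.2.le]

/-- The integrand `-log(1-u)/u` has a removable singularity at the tangential end `0`;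
`dilogIntegrand` is its continuous extension, which makes the integral from `0` harmless. -/
theorem li2Along_integrand_initial :
    EqOn (fun u : ℝ => dilogIntegrand u)
      (fun u => li1Along (fullPath p) u * (deriv (fullPath p) u / fullPath p u))
      (Ioo 0 (p.source : ℝ)) := by
  intro u hu
  have h0 : (u : ℂ) ≠ 0 := by exact_mod_cast hu.1.ne'
  simp only
  rw [li1Along_initial p hu.1.le hu.2.le, (hasDerivAt_fullPath_initial p hu.2).deriv,
    fullPath_eq_id p hu.2.le, dilogIntegrand_of_ne h0]
  ring

theorem continuousOn_dilogIntegrand_ofReal :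
    ContinuousOn (fun u : ℝ => dilogIntegrand u) (Iio 1) :=
  differentiableOn_dilogIntegrand.continuousOn.comp (by fun_prop) fun u hu => by
    have := Complex.ofReal_mem_slitPlane.2 (sub_pos.2 hu)
    simpa using this

theorem li2Along_integrand_intervalIntegrable :
    IntervalIntegrable (fun u => li1Along (fullPath p) u * (deriv (fullPath p) u / fullPath p u))
      volume 0 (p.source : ℝ) := by
  refine ((continuousOn_dilogIntegrand_ofReal.mono fun u hu =>
    hu.2.trans_lt p.source.2.2).intervalIntegrable_of_Icc p.source.2.1.le).congr_uIoo ?_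
  rw [uIoo_of_le p.source.2.1.le]
  exact li2Along_integrand_initial p

theorem li2Along_initial : li2Along (fullPath p) (p.source : ℝ) = dilog (p.source : ℝ) := by
  have h0 := p.source.2.1.le
  have hd : ∀ u ∈ Icc 0 (p.source : ℝ), HasDerivAt (fun u : ℝ => dilog u) (dilogIntegrand u) u :=
    fun u hu => by
    have hm := Complex.ofReal_mem_slitPlane.2 (sub_pos.2 (hu.2.trans_lt p.source.2.2))
    have := (hasDerivAt_dilog' (z := u) (by simpa using hm)).comp u Complex.ofRealCLM.hasDerivAt
    exact HasDerivAt.congr_deriv this (by simp)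
  have hc : ContinuousOn (fun u : ℝ => dilogIntegrand u) (Icc 0 (p.source : ℝ)) :=
    continuousOn_dilogIntegrand_ofReal.mono fun u hu => hu.2.trans_lt p.source.2.2
  rw [li2Along, ← intervalIntegral.integral_congr_Ioo_of_le h0 (li2Along_integrand_initial p),
    integral_eq_sub_of_hasDerivAt_Ioo h0 (fun u hu => (hd u hu).continuousAt.continuousWithinAt)
      (fun u hu => hd u ⟨hu.1.le, hu.2.le⟩) hc fun u _ => rfl]
  simp

variable {p}

theorem TangentialPath.IsC1.hasDerivAt_extend (hp : p.IsC1) {s : ℝ} (hs : s ∈ Ioo (0 : ℝ) 1) :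
    HasDerivAt (fun s => (p.path.extend s : ℂ))
      (derivWithin (fun s => (p.path.extend s : ℂ)) (Icc 0 1) s) s :=
  ((hp.differentiableOn one_ne_zero s
    (Ioo_subset_Icc_self hs)).hasDerivWithinAt).hasDerivAt (Icc_mem_nhds hs.1 hs.2)

/-- Along a continuously differentiable path, the continuation of `(log, Li₁, Li₂)` is
given by the line integrals. -/
theorem Continuation.eq_integrals (hp : p.IsC1) {w : ℂ × ℂ × ℂ}
    (h : Continuation p.path (principalPolylog (p.source : ℝ)) w) :
    (∫ u in (p.source : ℝ)..(p.source + 1 : ℝ), deriv (fullPath p) u / fullPath p u) =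
        w.1 - Complex.log (p.source : ℝ) ∧
      li2Along (fullPath p) (p.source + 1) = w.2.2 := by
  obtain ⟨L, hL, hL0, hL1⟩ := h
  set ρ : ℝ := (p.source : ℝ) with hρ
  have hρ0 : 0 ≤ ρ := p.source.2.1.le
  set D : ℝ → ℂ := derivWithin (fun s => (p.path.extend s : ℂ)) (Icc 0 1) with hD
  -- `N` is the lift in the parameter of `fullPath`, where `p.path` occupies `[ρ, ρ + 1]`; `projIcc`
  -- makes it constant outside.
  let N : ℝ → ℂ × ℂ × ℂ := fun x => L (projIcc 0 1 zero_le_one (x - ρ))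
  have hNc : Continuous N := (hL.continuous (by fun_prop)).comp (by fun_prop)
  have hNρ : N ρ = principalPolylog ρ := by simp [N, hL0]
  have hN1 : N (ρ + 1) = w := by simp [N, hL1]
  have hsub : ∀ {x}, x ∈ Ioo ρ (ρ + 1) → x - ρ ∈ Ioo (0 : ℝ) 1 := fun hx =>
    ⟨by linarith [hx.1], by linarith [hx.2]⟩
  have hfd : ∀ x ∈ Ioo ρ (ρ + 1), HasDerivAt (fullPath p) (D (x - ρ)) x := fun x hx => by
    refine ((hp.hasDerivAt_extend (hsub hx)).comp_sub_const x ρ).congr_of_eventuallyEq ?_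
    filter_upwards [Ioi_mem_nhds hx.1] with y hy
    exact fullPath_eq_extend p (le_of_lt hy)
  have hNd : ∀ x ∈ Ioo ρ (ρ + 1), HasDerivAt N (deriv (fullPath p) x / fullPath p x,
      deriv (fullPath p) x / (1 - fullPath p x),
      (N x).2.1 * (deriv (fullPath p) x / fullPath p x)) x := by
    intro x hx
    obtain ⟨F, W, hW, hm, hF, he⟩ := hL (projIcc 0 1 zero_le_one (x - ρ))
    have hxe : ∀ y ∈ Ioo ρ (ρ + 1), (p.path (projIcc 0 1 zero_le_one (y - ρ)) : ℂ) = fullPath p y :=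
      fun y hy => by
      rw [fullPath_eq_extend p hy.1.le]
      rfl
    simp only [hxe x hx] at hm
    have hNF : N =ᶠ[𝓝 x] F ∘ fullPath p := by
      have hc : Continuous fun y : ℝ => projIcc (0 : ℝ) 1 zero_le_one (y - ρ) := by fun_prop
      filter_upwards [hc.continuousAt.eventually he, Ioo_mem_nhds hx.1 hx.2] with y h1 h2
      simp only [N, h1, Function.comp_apply, hxe y h2]
    rw [(hfd x hx).deriv, hNF.self_of_nhds]
    refine HasDerivAt.congr_of_eventuallyEq ?_ hNF
    have := (hF _ hm).scomp x (hfd x hx)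
    refine this.congr_deriv ?_
    ext <;> simp <;> ring
  have hes : ∀ x ∈ Icc ρ (ρ + 1), x - ρ ∈ Icc (0 : ℝ) 1 := fun x hx =>
    ⟨by linarith [hx.1], by linarith [hx.2]⟩
  have hDc : ContinuousOn (fun x => D (x - ρ)) (Icc ρ (ρ + 1)) :=
    (hp.continuousOn_derivWithin (uniqueDiffOn_Icc zero_lt_one) le_rfl).comp (by fun_prop) hes
  have hec : Continuous fun x => (p.path.extend (x - ρ) : ℂ) :=
    continuous_subtype_val.comp (p.path.continuous_extend.comp (by fun_prop))
  have hg0 : ContinuousOn (fun x => D (x - ρ) / p.path.extend (x - ρ)) (Icc ρ (ρ + 1)) :=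
    hDc.div hec.continuousOn fun x _ => (p.path.extend (x - ρ)).2.1
  have hg1 : ContinuousOn (fun x => D (x - ρ) / (1 - p.path.extend (x - ρ))) (Icc ρ (ρ + 1)) :=
    hDc.div (by fun_prop) fun x _ => sub_ne_zero.2 (p.path.extend (x - ρ)).2.2.symm
  have hg2 : ContinuousOn (fun x => (N x).2.1 * (D (x - ρ) / p.path.extend (x - ρ)))
      (Icc ρ (ρ + 1)) := hNc.snd.fst.continuousOn.mul hg0
  have heq0 : EqOn (fun x => D (x - ρ) / p.path.extend (x - ρ))
      (fun x => deriv (fullPath p) x / fullPath p x) (Ioo ρ (ρ + 1)) := fun x hx => by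
    simp only [(hfd x hx).deriv, fullPath_eq_extend p hx.1.le]
    rfl
  have heq1 : EqOn (fun x => D (x - ρ) / (1 - p.path.extend (x - ρ)))
      (fun x => deriv (fullPath p) x / (1 - fullPath p x)) (Ioo ρ (ρ + 1)) := fun x hx => by
    simp only [(hfd x hx).deriv, fullPath_eq_extend p hx.1.le]
    rfl
  have hρ1 : ρ ≤ ρ + 1 := by linarith
  -- The inner integral is needed at every intermediate parameter, not only at the end, because it
  -- is a factor of the integrand of `Li₂`.
  have hli1 : ∀ s ∈ Icc ρ (ρ + 1), li1Along (fullPath p) s = (N s).2.1 := by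
    intro s hs
    have hint : IntervalIntegrable (fun u => deriv (fullPath p) u / (1 - fullPath p u))
        volume ρ s := by
      refine ((hg1.mono (Icc_subset_Icc_right hs.2)).intervalIntegrable_of_Icc hs.1).congr_uIoo ?_
      rw [uIoo_of_le hs.1]
      exact heq1.mono (Ioo_subset_Ioo_right hs.2)
    have h1 := integral_eq_sub_of_hasDerivAt_Ioo hs.1 hNc.snd.fst.continuousOn
      (fun x hx => (hNd x ⟨hx.1, hx.2.trans_le hs.2⟩).snd.fst)
      (hg1.mono (Icc_subset_Icc_right hs.2)) (heq1.mono (Ioo_subset_Ioo_right hs.2))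
    have h2 := li1Along_initial p hρ0 le_rfl
    rw [li1Along] at h2 ⊢
    rw [← intervalIntegral.integral_add_adjacent_intervals
      (li1Along_integrand_intervalIntegrable p) hint, h2]
    simp only at h1
    rw [h1, hNρ]
    simp [principalPolylog]
  refine ⟨?_, ?_⟩
  · have h1 := integral_eq_sub_of_hasDerivAt_Ioo hρ1 hNc.fst.continuousOn
      (fun x hx => (hNd x hx).fst) hg0 heq0
    simp only at h1
    rw [h1, hN1, hNρ]
    rfl
  · have heq2 : EqOn (fun x => (N x).2.1 * (D (x - ρ) / p.path.extend (x - ρ)))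
        (fun x => (N x).2.1 * (deriv (fullPath p) x / fullPath p x)) (Ioo ρ (ρ + 1)) :=
      fun x hx => congrArg ((N x).2.1 * ·) (heq0 hx)
    have heq3 : EqOn (fun x => (N x).2.1 * (deriv (fullPath p) x / fullPath p x))
        (fun x => li1Along (fullPath p) x * (deriv (fullPath p) x / fullPath p x))
        (Ioo ρ (ρ + 1)) := fun x hx => by
      simp only [hli1 x ⟨hx.1.le, hx.2.le⟩]
    have hint : IntervalIntegrable
        (fun u => li1Along (fullPath p) u * (deriv (fullPath p) u / fullPath p u))
        volume ρ (ρ + 1) := by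
      refine (hg2.intervalIntegrable_of_Icc hρ1).congr_uIoo ?_
      rw [uIoo_of_le hρ1]
      exact heq2.trans heq3
    have h1 := integral_eq_sub_of_hasDerivAt_Ioo hρ1 hNc.snd.snd.continuousOn
      (fun x hx => (hNd x hx).snd.snd) hg2 heq2
    have h2 := li2Along_initial p
    rw [li2Along] at h2 ⊢
    rw [← intervalIntegral.integral_add_adjacent_intervals
      (li2Along_integrand_intervalIntegrable p) hint, h2,
      ← intervalIntegral.integral_congr_Ioo_of_le hρ1 heq3]
    simp only at h1
    rw [h1, hN1, hNρ]
    exact add_sub_cancel _ _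

end FullPath

/-- The functions `log(z; γ)` and `Li₂(z; γ)` are computed by continuation of the principal
determination along any path in the class `γ`. -/
theorem pathLog_pathLi₂_eq {z : P1} {p : TangentialPath tan01 (BasePoint.ofPoint z)}
    {w : ℂ × ℂ × ℂ} (h : Continuation p.path (principalPolylog (p.source : ℝ)) w) :
    pathLog z (PathClass.mk p) = w.1 ∧ pathLi₂ z (PathClass.mk p) = w.2.2 := by
  have hC1 : (smoothRep (PathClass.mk p)).IsC1 := (exists_isC1 (PathClass.mk p)).choose_spec.1
  have hmk : PathClass.mk (smoothRep (PathClass.mk p)) = PathClass.mk p :=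
    (exists_isC1 (PathClass.mk p)).choose_spec.2
  have hh : p.Homotopic (smoothRep (PathClass.mk p)) :=
    Quotient.exact (s := tangentialSetoid _ _) hmk.symm
  obtain ⟨h1, h2⟩ := (h.of_tangential_homotopic hh).eq_integrals hC1
  refine ⟨?_, h2⟩
  have hs := (smoothRep (PathClass.mk p)).source.2.1
  have hlog : (∫ u in (1 : ℝ)..((smoothRep (PathClass.mk p)).source : ℝ), (1 / u : ℂ)) =
      Complex.log ((smoothRep (PathClass.mk p)).source : ℝ) := by
    have e := integral_one_div_of_pos zero_lt_one hs
    rw [div_one] at e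
    rw [← Complex.ofReal_log hs.le, ← e, ← intervalIntegral.integral_ofReal]
    simp
  rw [pathLog, hlog, h1]
  ring

/-! ### The infinitesimal form of the functional equations -/

/-- The nine rational functions, on `ℂ × ℂ`. -/
noncomputable def nineFun (x y : ℂ) : Fin 9 → ℂ :=
  ![x * (1 - y) ^ 2 / (y * (1 - x) ^ 2), x * y, x / y, x * (1 - y) / (y * (1 - x)),
    -(x * (1 - y) / (1 - x)), (1 - y) / (1 - x), -((1 - y) / (y * (1 - x))), x, y]

/-- The nine maps on the complement of the non-Fano arrangement. -/
noncomputable def nineMap : Fin 9 → C(VnonFano, P1) := ![f₁, f₂, f₃, f₄, f₅, f₆, f₇, f₈, f₉]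

/-- The index `i` stands for the map numbered `i + 1`. In the fifth and seventh functions the sign
is moved out of `x - 1`, so that `1 - x` is the only form of this factor in the denominators. -/
theorem nineMap_apply (i : Fin 9) (p : VnonFano) : (nineMap i p : ℂ) = nineFun p.1.1 p.1.2 i := by
  obtain ⟨-, h2, h3, -⟩ := p.ne
  have h7 := p.ne'
  fin_cases i
  all_goals try rfl
  · change p.1.1 * (1 - p.1.2) / (p.1.1 - 1) = -(p.1.1 * (1 - p.1.2) / (1 - p.1.1))
    rw [← neg_sub 1 p.1.1, div_neg]
  · change (1 - p.1.2) / (p.1.2 * (p.1.1 - 1)) = -((1 - p.1.2) / (p.1.2 * (1 - p.1.1)))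
    rw [← neg_sub 1 p.1.1, mul_neg, div_neg]

/-- The logarithmic derivatives of the nine functions. -/
noncomputable def nineLogDeriv (x y x' y' : ℂ) : Fin 9 → ℂ :=
  ![x' / x - 2 * (y' / (1 - y)) - y' / y + 2 * (x' / (1 - x)), x' / x + y' / y, x' / x - y' / y,
    x' / x - y' / (1 - y) - y' / y + x' / (1 - x), x' / x - y' / (1 - y) + x' / (1 - x),
    x' / (1 - x) - y' / (1 - y), -(y' / (1 - y)) - y' / y + x' / (1 - x), x' / x, y' / y]

/-- The derivatives of `-log (1 - f)` for the nine functions `f`. -/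
noncomputable def nineLi1Deriv (x y x' y' : ℂ) : Fin 9 → ℂ :=
  ![(x' - x * y' / y) / (y - x) + (x' * y + x * y') / (1 - x * y) - 2 * (x' / (1 - x)),
    (x' * y + x * y') / (1 - x * y),
    (x' - x * y' / y) / (y - x),
    (x' - x * y' / y) / (y - x) - x' / (1 - x),
    (x' * y + x * y') / (1 - x * y) - x' / (1 - x),
    (x' - x * y' / y) / (y - x) - y' / y - x' / (1 - x),
    (x' * y + x * y') / (1 - x * y) + y' / y - x' / (1 - x),
    x' / (1 - x), y' / (1 - y)]

section Curve

variable {x y : ℝ → ℂ} {x' y' : ℂ} {t : ℝ}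

theorem hasDerivAt_nineFun (h1 : x t ≠ 0) (h2 : y t ≠ 0) (h3 : 1 - x t ≠ 0) (h4 : 1 - y t ≠ 0)
    (hx : HasDerivAt x x' t) (hy : HasDerivAt y y' t) (i : Fin 9) :
    HasDerivAt (fun t => nineFun (x t) (y t) i)
      (nineFun (x t) (y t) i * nineLogDeriv (x t) (y t) x' y' i) t := by
  have hx1 := hx.const_sub 1
  have hy1 := hy.const_sub 1
  fin_cases i
  · refine ((hx.mul (hy1.pow 2)).div (hy.mul (hx1.pow 2)) (by simp [*])).congr_deriv ?_
    simp [nineFun, nineLogDeriv]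
    field_simp
    ring
  · refine (hx.mul hy).congr_deriv ?_
    simp [nineFun, nineLogDeriv]
    field_simp
  · refine (hx.div hy h2).congr_deriv ?_
    simp [nineFun, nineLogDeriv]
    field_simp
  · refine ((hx.mul hy1).div (hy.mul hx1) (by simp [*])).congr_deriv ?_
    simp [nineFun, nineLogDeriv]
    field_simp
    ring
  · refine ((hx.mul hy1).div hx1 h3).neg.congr_deriv ?_
    simp [nineFun, nineLogDeriv]
    field_simp
    ring
  · refine (hy1.div hx1 h3).congr_deriv ?_
    simp [nineFun, nineLogDeriv]
    field_simp
    ring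
  · refine (hy1.div (hy.mul hx1) (by simp [*])).neg.congr_deriv ?_
    simp [nineFun, nineLogDeriv]
    field_simp
    ring
  · refine hx.congr_deriv ?_
    simp [nineFun, nineLogDeriv]
    field_simp
  · refine hy.congr_deriv ?_
    simp [nineFun, nineLogDeriv]
    field_simp

/-- This is `d(-log(1 - f)) = df / (1 - f)` with the denominator cleared. The entries of
`nineLi1Deriv` come from the factorizations `1 - f₁ = (y-x)(1-xy)/(y(1-x)²)`, `1 - f₃ = (y-x)/y`, `1
- f₄ = (y-x)/(y(1-x))`, `1 - f₅ = (1-xy)/(1-x)`, `1 - f₆ = (y-x)/(1-x)` and `1 - f₇ =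
(1-xy)/(y(1-x))`. -/
theorem one_sub_nineFun_mul_nineLi1Deriv {x y : ℂ} (h1 : x ≠ 0) (h2 : y ≠ 0) (h3 : 1 - x ≠ 0)
    (h4 : 1 - y ≠ 0) (h5 : y - x ≠ 0) (h6 : 1 - x * y ≠ 0) (x' y' : ℂ) (i : Fin 9) :
    (1 - nineFun x y i) * nineLi1Deriv x y x' y' i = nineFun x y i * nineLogDeriv x y x' y' i := by
  have h6' : 1 - y * x ≠ 0 := mul_comm x y ▸ h6
  fin_cases i <;> simp [nineFun, nineLi1Deriv, nineLogDeriv] <;> field_simp <;> ring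

/-- The derivative of a determination of `(log, Li₁, Li₂)` along the image of a curve under one of
the nine functions. -/
theorem IsPolylogSolution.hasDerivAt_comp_nineFun {F : ℂ → ℂ × ℂ × ℂ} {W : Set ℂ}
    (hF : IsPolylogSolution F W)
    (hV : x t * y t * (1 - x t) * (1 - y t) * (x t - y t) * (1 - x t * y t) ≠ 0)
    (hx : HasDerivAt x x' t) (hy : HasDerivAt y y' t) (i : Fin 9)
    (hW : nineFun (x t) (y t) i ∈ W) :
    HasDerivAt (fun t => F (nineFun (x t) (y t) i))
      (nineLogDeriv (x t) (y t) x' y' i, nineLi1Deriv (x t) (y t) x' y' i,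
        (F (nineFun (x t) (y t) i)).2.1 * nineLogDeriv (x t) (y t) x' y' i) t := by
  obtain ⟨h1, h2, h3, h4, h5, h6⟩ := VnonFano.ne ⟨(x t, y t), hV⟩
  have hp := (nineMap i ⟨(x t, y t), hV⟩).2
  rw [nineMap_apply] at hp
  simp only at h1 h2 h3 h4 h5 h6 hp
  have h0' : nineFun (x t) (y t) i ≠ 0 := hp.1
  have h1' : 1 - nineFun (x t) (y t) i ≠ 0 := sub_ne_zero.2 hp.2.symm
  have h5' : y t - x t ≠ 0 := by
    rw [← neg_sub]
    exact neg_ne_zero.2 h5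
  have e := one_sub_nineFun_mul_nineLi1Deriv h1 h2 h3 h4 h5' h6 x' y' i
  refine ((hF _ hW).scomp t (hasDerivAt_nineFun h1 h2 h3 h4 hx hy i)).congr_deriv ?_
  have e' : nineLi1Deriv (x t) (y t) x' y' i = nineFun (x t) (y t) i *
      nineLogDeriv (x t) (y t) x' y' i / (1 - nineFun (x t) (y t) i) := by
    rw [← e]
    field_simp
  rw [e']
  simp only [Prod.smul_mk, smul_eq_mul, Prod.mk.injEq]
  refine ⟨?_, ?_, ?_⟩ <;> field_simp

end Curve

/-! ### Relations between the logarithms and cancellation of the dilogarithm differentials. -/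

/-- The defects of the relations between the logarithms `log f`, `log (1 - f)` of the nine
functions. -/
noncomputable def logDefect (M : Fin 9 → ℂ × ℂ × ℂ) : Fin 6 → ℂ :=
  ![(M 3).2.1 - (M 2).2.1 + (M 7).2.1,
    (M 5).2.1 - (M 2).2.1 + (M 8).1 + (M 7).2.1,
    (M 0).2.1 - (M 2).2.1 - (M 1).2.1 + 2 * (M 7).2.1,
    (M 4).2.1 - (M 1).2.1 + (M 7).2.1,
    (M 6).2.1 - (M 1).2.1 - (M 8).1 + (M 7).2.1,
    (M 5).1 - (M 7).2.1 + (M 8).2.1]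

/-- The combinations of dilogarithms and logarithms in the equations of Schaeffer, Kummer and
Hill. -/
noncomputable def dilogDefect (M : Fin 9 → ℂ × ℂ × ℂ) : Fin 3 → ℂ :=
  ![(M 3).2.2 - (M 8).2.2 + (M 7).2.2 - (M 2).2.2 - (M 5).2.2 - (M 8).1 * (M 5).1,
    (M 0).2.2 - (M 4).2.2 - (M 6).2.2 - (M 3).2.2 - (M 5).2.2 - 1 / 2 * (M 8).1 ^ 2,
    (M 6).2.2 + (M 1).2.2 - (M 7).2.2 - (M 8).2.2 - (M 4).2.2 - (M 8).1 * (M 5).1 +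
      1 / 2 * (M 8).1 ^ 2]

theorem continuous_logDefect : Continuous logDefect := by
  refine continuous_pi fun j => ?_
  fin_cases j <;> simp only [logDefect] <;> simp <;> fun_prop

theorem continuous_dilogDefect : Continuous dilogDefect := by
  refine continuous_pi fun j => ?_
  fin_cases j <;> simp only [dilogDefect] <;> simp <;> fun_prop

section Defect

variable {M : ℝ → Fin 9 → ℂ × ℂ × ℂ} {x y x' y' : ℂ} {t : ℝ}

theorem hasDerivAt_logDefect (hM : ∀ i, HasDerivAt (fun t => M t i) (nineLogDeriv x y x' y' i,
      nineLi1Deriv x y x' y' i, (M t i).2.1 * nineLogDeriv x y x' y' i) t) :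
    HasDerivAt (fun t => logDefect (M t)) 0 t := by
  have hA : ∀ i, HasDerivAt (fun t => (M t i).1) (nineLogDeriv x y x' y' i) t :=
    fun i => (hM i).fst
  have hB : ∀ i, HasDerivAt (fun t => (M t i).2.1) (nineLi1Deriv x y x' y' i) t :=
    fun i => (hM i).snd.fst
  refine hasDerivAt_pi.2 fun j => ?_
  fin_cases j
  · refine (((hB 3).sub (hB 2)).add (hB 7)).congr_deriv ?_
    simp [nineLi1Deriv]
  · refine ((((hB 5).sub (hB 2)).add (hA 8)).add (hB 7)).congr_deriv ?_
    simp [nineLi1Deriv, nineLogDeriv]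
    ring
  · refine ((((hB 0).sub (hB 2)).sub (hB 1)).add ((hB 7).const_mul 2)).congr_deriv ?_
    simp [nineLi1Deriv]
    ring
  · refine (((hB 4).sub (hB 1)).add (hB 7)).congr_deriv ?_
    simp [nineLi1Deriv]
  · refine ((((hB 6).sub (hB 1)).sub (hA 8)).add (hB 7)).congr_deriv ?_
    simp [nineLi1Deriv, nineLogDeriv]
    ring
  · refine (((hA 5).sub (hB 7)).add (hB 8)).congr_deriv ?_
    simp [nineLi1Deriv, nineLogDeriv]

/-- Differentiation turns each dilogarithm into `Li₁(f) · d log f`. The relations between the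
logarithms must hold exactly here, not merely up to constants, for these products to cancel. -/
theorem hasDerivAt_dilogDefect (hM : ∀ i, HasDerivAt (fun t => M t i) (nineLogDeriv x y x' y' i,
      nineLi1Deriv x y x' y' i, (M t i).2.1 * nineLogDeriv x y x' y' i) t)
    (h0 : logDefect (M t) = 0) : HasDerivAt (fun t => dilogDefect (M t)) 0 t := by
  have hA : ∀ i, HasDerivAt (fun t => (M t i).1) (nineLogDeriv x y x' y' i) t :=
    fun i => (hM i).fst
  have hC : ∀ i, HasDerivAt (fun t => (M t i).2.2)
      ((M t i).2.1 * nineLogDeriv x y x' y' i) t := fun i => (hM i).snd.snd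
  have e := fun j => congrFun h0 j
  have e0 := e 0
  have e1 := e 1
  have e2 := e 2
  have e3 := e 3
  have e4 := e 4
  have e5 := e 5
  clear e h0 hM
  simp [logDefect] at e0 e1 e2 e3 e4 e5
  refine hasDerivAt_pi.2 fun j => ?_
  fin_cases j
  · refine ((((((hC 3).sub (hC 8)).add (hC 7)).sub (hC 2)).sub (hC 5)).sub
      ((hA 8).mul (hA 5))).congr_deriv ?_
    simp [nineLogDeriv]
    generalize x' / x = a, y' / y = b, x' / (1 - x) = c, y' / (1 - y) = d
    -- Each coefficient belongs to a quantity being eliminated: `a - d - b + c` and `c - d` are the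
    -- logarithmic derivatives of `f₄` and `f₆`, which multiply `Li₁(f₄)` and `Li₁(f₆)`, while `b`
    -- multiplies `log f₆` in the derivative of `log y · log f₆`. The other two equations follow the
    -- same rule.
    linear_combination (a - d - b + c) * e0 - (c - d) * e1 - b * e5
  · refine ((((((hC 0).sub (hC 4)).sub (hC 6)).sub (hC 3)).sub (hC 5)).sub
      (((hA 8).pow 2).const_mul (1 / 2))).congr_deriv ?_
    simp [nineLogDeriv]
    generalize x' / x = a, y' / y = b, x' / (1 - x) = c, y' / (1 - y) = d
    linear_combination (a - 2 * d - b + 2 * c) * e2 - (a - d + c) * e3 - (-d - b + c) * e4 -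
      (a - d - b + c) * e0 - (c - d) * e1
  · refine (((((((hC 6).add (hC 1)).sub (hC 7)).sub (hC 8)).sub (hC 4)).sub
      ((hA 8).mul (hA 5))).add (((hA 8).pow 2).const_mul (1 / 2))).congr_deriv ?_
    simp [nineLogDeriv]
    generalize x' / x = a, y' / y = b, x' / (1 - x) = c, y' / (1 - y) = d
    linear_combination (-d - b + c) * e4 - (a - d + c) * e3 - b * e5

end Defect

/-! ### Propagation of the equations under continuation. -/

/-- The functional equations, for values of `(log, Li₁, Li₂)` at the nine functions. -/
def FunctionalEquations (M : Fin 9 → ℂ × ℂ × ℂ) : Prop :=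
  logDefect M = 0 ∧ dilogDefect M = ![-((Real.pi : ℂ) ^ 2 / 6), 0, -((Real.pi : ℂ) ^ 2 / 6)]

theorem isClosed_functionalEquations : IsClosed {M | FunctionalEquations M} :=
  (isClosed_eq continuous_logDefect continuous_const).inter
    (isClosed_eq continuous_dilogDefect continuous_const)

theorem hasDerivAt_affine (a b : ℂ) (t : ℝ) : HasDerivAt (fun t : ℝ => a + t * b) b t :=
  (((Complex.ofRealCLM.hasDerivAt (x := t)).mul_const b).const_add a).congr_deriv (by simp)

theorem functionalEquations_of_segment {F : Fin 9 → ℂ → ℂ × ℂ × ℂ} {W : Fin 9 → Set ℂ}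
    (hF : ∀ i, IsPolylogSolution (F i) (W i)) {x y x' y' : ℂ}
    (hV : ∀ t ∈ Icc (0 : ℝ) 1, ∃ v : VnonFano, v.1 = (x + t * x', y + t * y') ∧
      ∀ i, (nineMap i v : ℂ) ∈ W i)
    (h0 : FunctionalEquations fun i => F i (nineFun x y i)) :
    FunctionalEquations fun i => F i (nineFun (x + x') (y + y') i) := by
  let M : ℝ → Fin 9 → ℂ × ℂ × ℂ := fun t i => F i (nineFun (x + t * x') (y + t * y') i)
  have hM : ∀ t ∈ Icc (0 : ℝ) 1, ∀ i, HasDerivAt (fun t => M t i)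
      (nineLogDeriv (x + t * x') (y + t * y') x' y' i,
      nineLi1Deriv (x + t * x') (y + t * y') x' y' i,
      (M t i).2.1 * nineLogDeriv (x + t * x') (y + t * y') x' y' i) t := by
    intro t ht i
    obtain ⟨v, hv, hvW⟩ := hV t ht
    have hvW := hvW i
    have hvV := v.2
    rw [nineMap_apply] at hvW
    rw [hv] at hvW hvV
    exact (hF i).hasDerivAt_comp_nineFun (x := fun t => x + t * x') (y := fun t => y + t * y')
      hvV (hasDerivAt_affine x x' t) (hasDerivAt_affine y y' t) i hvW
  have hM0 : M 0 = fun i => F i (nineFun x y i) := by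
    simp [M]
  have hM1 : M 1 = fun i => F i (nineFun (x + x') (y + y') i) := by
    simp [M]
  rw [← hM0] at h0
  rw [← hM1]
  -- The logarithmic relations come first on the whole segment: the derivative of `dilogDefect` is
  -- known to vanish only where they hold.
  have hlog : ∀ t ∈ Icc (0 : ℝ) 1, logDefect (M t) = 0 := fun t ht =>
    (constant_of_has_deriv_right_zero
      (fun t ht => (hasDerivAt_logDefect (hM t ht)).continuousAt.continuousWithinAt)
      (fun t ht => (hasDerivAt_logDefect (hM t (Ico_subset_Icc_self ht))).hasDerivWithinAt)
      t ht).trans h0.1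
  have hdilog : ∀ t ∈ Icc (0 : ℝ) 1, HasDerivAt (fun t => dilogDefect (M t)) 0 t :=
    fun t ht => hasDerivAt_dilogDefect (hM t ht) (hlog t ht)
  refine ⟨hlog 1 (by simp), (constant_of_has_deriv_right_zero
    (fun t ht => (hdilog t ht).continuousAt.continuousWithinAt)
    (fun t ht => (hdilog t (Ico_subset_Icc_self ht)).hasDerivWithinAt) 1 (by simp)).trans h0.2⟩

/-- The functional equations are preserved under analytic continuation along a path in the
complement of the non-Fano arrangement. -/
theorem functionalEquations_of_lift {q : I → VnonFano} (hq : Continuous q)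
    {L : Fin 9 → I → ℂ × ℂ × ℂ} (hL : ∀ i, IsPolylogLift (fun t => (nineMap i (q t) : ℂ)) (L i))
    (h0 : FunctionalEquations fun i => L i 0) : FunctionalEquations fun i => L i 1 := by
  have hLc : ∀ i, Continuous (L i) := fun i => (hL i).continuous (by fun_prop)
  have hcl : IsClopen {s : I | FunctionalEquations fun i => L i s} := by
    refine ⟨isClosed_functionalEquations.preimage (continuous_pi hLc),
      isOpen_iff_mem_nhds.2 fun s hs => ?_⟩
    -- For openness, differentiation along `q` is impossible, since `q` is only continuous. Near `q
    -- s` the lifts are the functions `F i ∘ fᵢ`, which can be followed along a straight segment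
    -- from `q s` to `q s'` instead.
    choose F W hW hm hF he using fun i => hL i s
    have hopen : IsOpen {p : ℂ × ℂ |
        p.1 * p.2 * (1 - p.1) * (1 - p.2) * (p.1 - p.2) * (1 - p.1 * p.2) ≠ 0} :=
      isOpen_ne_fun (by fun_prop) (by fun_prop)
    have hU : ∀ᶠ v : VnonFano in 𝓝 (q s), ∀ i, (nineMap i v : ℂ) ∈ W i :=
      eventually_all.2 fun i => (show Continuous fun v => (nineMap i v : ℂ) by
        fun_prop).continuousAt.eventually ((hW i).mem_nhds (hm i))
    -- The complement is open in `ℂ²`, so a ball of `ℂ²` about `q s` lies in it and is mapped into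
    -- every `W i`. Convexity of this ball keeps the segment inside.
    have hU' := hopen.isOpenEmbedding_subtypeVal.isOpenMap.image_mem_nhds hU
    obtain ⟨r, hr, hrU⟩ := Metric.mem_nhds_iff.1 hU'
    have hqs : ∀ᶠ s' in 𝓝 s, (q s').1 ∈ Metric.ball (q s).1 r :=
      (show Continuous fun s => (q s).1 by fun_prop).continuousAt.eventually
        (Metric.ball_mem_nhds _ hr)
    filter_upwards [hqs, eventually_all.2 he] with s' h1 h2
    have hM0 : (fun i => F i (nineFun (q s).1.1 (q s).1.2 i)) = fun i => L i s := by
      funext i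
      simp only [(he i).self_of_nhds, nineMap_apply]
    have hM1 : (fun i => F i (nineFun ((q s).1.1 + ((q s').1.1 - (q s).1.1))
        ((q s).1.2 + ((q s').1.2 - (q s).1.2)) i)) = fun i => L i s' := by
      funext i
      rw [h2 i, nineMap_apply, add_sub_cancel, add_sub_cancel]
    have hs' : FunctionalEquations fun i => L i s := hs
    rw [← hM0] at hs'
    have key := functionalEquations_of_segment hF (x' := (q s').1.1 - (q s).1.1)
      (y' := (q s').1.2 - (q s).1.2) (fun t ht => ?_) hs'
    · rw [hM1] at key
      exact key
    · obtain ⟨v, hv, hvt⟩ := hrU ((convex_ball (q s).1 r).add_smul_sub_mem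
        (Metric.mem_ball_self hr) h1 ht)
      refine ⟨v, hvt.trans ?_, hv⟩
      ext <;> simp
  have := hcl.eq_univ ⟨0, h0⟩
  have h1 : (1 : I) ∈ {s : I | FunctionalEquations fun i => L i s} := this ▸ mem_univ _
  exact h1

/-! ### The functional equations along the tangential base point -/

/-- The determination of `(log, Li₁, Li₂)` obtained from the principal one by continuation through
the upper half plane. -/
noncomputable def upperPolylog (z : ℂ) : ℂ × ℂ × ℂ :=
  (Complex.log (-Complex.I * z) + Real.pi / 2 * Complex.I, -Complex.log (1 - z), dilog z)

/-- The plane cut along the negative imaginary axis and `[1, ∞)`. -/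
def upperSlitPlane : Set ℂ := {z | -Complex.I * z ∈ Complex.slitPlane ∧ 1 - z ∈ Complex.slitPlane}

theorem isOpen_upperSlitPlane : IsOpen upperSlitPlane :=
  (Complex.isOpen_slitPlane.preimage (by fun_prop)).inter isOpen_one_sub_mem_slitPlane

theorem isPolylogSolution_upperPolylog : IsPolylogSolution upperPolylog upperSlitPlane := by
  rintro z ⟨h0, h1⟩
  have hz : z ≠ 0 := right_ne_zero_of_mul (Complex.slitPlane_ne_zero h0)
  refine HasDerivAt.prodMk ?_ ((hasDerivAt_neg_log_one_sub h1).prodMk (hasDerivAt_dilog h1 hz))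
  refine ((((hasDerivAt_id z).const_mul (-Complex.I)).clog h0).add_const _).congr_deriv ?_
  simp only [id_eq]
  field_simp

/-- The constant `πi/2` in `upperPolylog` compensates `log(-i) = -πi/2`. Only the first component
differs in form from the principal determination. -/
theorem upperPolylog_ofReal {r : ℝ} (hr : 0 < r) : upperPolylog r = principalPolylog r := by
  have h : Complex.log (-Complex.I * r) = Complex.log r - Real.pi / 2 * Complex.I := by
    rw [mul_comm, Complex.log_ofReal_mul hr (neg_ne_zero.2 Complex.I_ne_zero), Complex.log_neg_I,
      Complex.ofReal_log hr.le]
    ring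
  simp only [upperPolylog, principalPolylog, h]
  ring_nf

theorem mem_upperSlitPlane {z : ℂ} :
    z ∈ upperSlitPlane ↔ (0 < z.im ∨ z.re ≠ 0) ∧ (z.re < 1 ∨ z.im ≠ 0) := by
  simp [upperSlitPlane, Complex.mem_slitPlane_iff]

theorem neg_ofReal_mem_upperSlitPlane {r : ℝ} (hr : 0 < r) : -(r : ℂ) ∈ upperSlitPlane := by
  rw [mem_upperSlitPlane]
  simp only [Complex.neg_re, Complex.ofReal_re]
  exact ⟨Or.inr (by linarith [hr] |> fun (h : -r < 0) => h.ne), Or.inl (by linarith)⟩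

/-- The determinations of `(log, Li₁, Li₂)` at the end of the paths `δ₁, …, δ₉`. -/
noncomputable def branch : Fin 9 → ℂ → ℂ × ℂ × ℂ :=
  ![principalPolylog, principalPolylog, principalPolylog, principalPolylog, upperPolylog,
    principalPolylog, upperPolylog, principalPolylog, principalPolylog]

/-- The domains of the determinations `branch`. -/
def branchDomain : Fin 9 → Set ℂ :=
  ![doublySlitPlane, doublySlitPlane, doublySlitPlane, doublySlitPlane, upperSlitPlane,
    doublySlitPlane, upperSlitPlane, doublySlitPlane, doublySlitPlane]

theorem isPolylogSolution_branch (i : Fin 9) : IsPolylogSolution (branch i) (branchDomain i) := by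
  fin_cases i
  all_goals first
    | exact isPolylogSolution_principalPolylog
    | exact isPolylogSolution_upperPolylog

/-- The values of the nine functions along the arc `t ↦ (t², t)`. -/
noncomputable def arcValue (t : ℝ) : Fin 9 → ℝ :=
  ![t / (1 + t) ^ 2, t ^ 3, t, t / (1 + t), -(t ^ 2 / (1 + t)), 1 / (1 + t), -(1 / (t * (1 + t))),
    t ^ 2, t]

/-! ### Verification on the arc and its limit at the tangential base point. -/

section Arc

variable {t : ℝ}

theorem nineFun_arc (ht : t ∈ Ioo (0 : ℝ) 1) (i : Fin 9) :
    nineFun ((t : ℂ) ^ 2) t i = (arcValue t i : ℂ) := by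
  have h0 : (t : ℂ) ≠ 0 := by exact_mod_cast ht.1.ne'
  have h1 : (1 : ℂ) - t ≠ 0 := by exact_mod_cast (sub_pos.2 ht.2).ne'
  have h2 : (1 : ℂ) + t ≠ 0 := by
    have : (1 : ℝ) + t ≠ 0 := by linarith [ht.1] |> fun (h : 0 < 1 + t) => h.ne'
    exact_mod_cast this
  have h3 : (1 : ℂ) - t ^ 2 = (1 - t) * (1 + t) := by ring
  fin_cases i <;> simp [nineFun, arcValue, h3] <;> field_simp

theorem arcValue_mem_branchDomain (ht : t ∈ Ioo (0 : ℝ) 1) (i : Fin 9) :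
    (arcValue t i : ℂ) ∈ branchDomain i := by
  obtain ⟨h0, h1⟩ := ht
  have h2 : 0 < 1 + t := by linarith
  fin_cases i
  · refine ofReal_mem_doublySlitPlane (by simp [arcValue]; positivity) ?_
    simp only [arcValue]
    simp
    rw [div_lt_one (by positivity)]
    nlinarith
  · exact ofReal_mem_doublySlitPlane (pow_pos h0 3) (pow_lt_one₀ h0.le h1 (by norm_num))
  · exact ofReal_mem_doublySlitPlane h0 h1
  · refine ofReal_mem_doublySlitPlane (div_pos h0 h2) ((div_lt_one h2).2 (by linarith))
  · have := neg_ofReal_mem_upperSlitPlane (r := t ^ 2 / (1 + t)) (by positivity)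
    rw [← Complex.ofReal_neg] at this
    exact this
  · refine ofReal_mem_doublySlitPlane (one_div_pos.2 h2) ((div_lt_one h2).2 (by linarith))
  · have := neg_ofReal_mem_upperSlitPlane (r := 1 / (t * (1 + t))) (by positivity)
    rw [← Complex.ofReal_neg] at this
    exact this
  · exact ofReal_mem_doublySlitPlane (pow_pos h0 2) (pow_lt_one₀ h0.le h1 (by norm_num))
  · exact ofReal_mem_doublySlitPlane h0 h1

/-- Both kinds of branch share the principal `Li₁`, and all nine numbers `1 - fᵢ` are positive on
the arc, so only real logarithms occur. -/
theorem branch_li1_arc (ht : t ∈ Ioo (0 : ℝ) 1) (i : Fin 9) :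
    (branch i (arcValue t i)).2.1 = ((-Real.log (1 - arcValue t i) : ℝ) : ℂ) := by
  have hlt : 0 ≤ 1 - arcValue t i := by
    have h := arcValue_mem_branchDomain ht i
    have h' : (1 : ℂ) - arcValue t i ∈ Complex.slitPlane := by
      fin_cases i <;> exact h.2
    rw [← Complex.ofReal_one, ← Complex.ofReal_sub, Complex.ofReal_mem_slitPlane] at h'
    exact h'.le
  have e : (branch i (arcValue t i)).2.1 = -Complex.log (1 - arcValue t i) := by
    fin_cases i <;> rfl
  rw [e, Complex.ofReal_neg, Complex.ofReal_log hlt]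
  push_cast
  rfl

/-- On the arc every `1 - fᵢ` is a product of powers of the positive numbers `t`, `1 - t`, `1 + t`
and `1 + t + t²`, so the relations hold without any ambiguity by multiples of `2πi`. -/
theorem logDefect_arc (ht : t ∈ Ioo (0 : ℝ) 1) :
    logDefect (fun i => branch i (arcValue t i)) = 0 := by
  have hl := branch_li1_arc ht
  obtain ⟨h0, h1⟩ := ht
  have h2 : 0 < 1 + t := by linarith
  have h3 : 0 < 1 - t := by linarith
  have h4 : 0 < 1 + t + t ^ 2 := by positivity
  have l8 : (branch 8 (arcValue t 8)).1 = ((Real.log t : ℝ) : ℂ) := (Complex.ofReal_log h0.le).symm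
  have l5 : (branch 5 (arcValue t 5)).1 = ((-Real.log (1 + t) : ℝ) : ℂ) := by
    have : -Real.log (1 + t) = Real.log (1 / (1 + t)) := by
      rw [one_div, Real.log_inv]
    rw [this]
    exact (Complex.ofReal_log (one_div_pos.2 h2).le).symm
  have r0 : -Real.log (1 - arcValue t 0) = 2 * Real.log (1 + t) - Real.log (1 + t + t ^ 2) := by
    rw [show 1 - arcValue t 0 = (1 + t + t ^ 2) / (1 + t) ^ 2 by
      simp [arcValue]; field_simp; ring, Real.log_div (by positivity) (by positivity), Real.log_pow]
    push_cast
    ring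
  have r1 : -Real.log (1 - arcValue t 1) = -Real.log (1 - t) - Real.log (1 + t + t ^ 2) := by
    rw [show 1 - arcValue t 1 = (1 - t) * (1 + t + t ^ 2) by simp [arcValue]; ring,
      Real.log_mul (by positivity) (by positivity)]
    ring
  have r2 : -Real.log (1 - arcValue t 2) = -Real.log (1 - t) := rfl
  have r3 : -Real.log (1 - arcValue t 3) = Real.log (1 + t) := by
    rw [show 1 - arcValue t 3 = (1 + t)⁻¹ by simp [arcValue]; field_simp; ring, Real.log_inv,
      neg_neg]
  have r4 : -Real.log (1 - arcValue t 4) = Real.log (1 + t) - Real.log (1 + t + t ^ 2) := by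
    rw [show 1 - arcValue t 4 = (1 + t + t ^ 2) / (1 + t) by simp [arcValue]; field_simp,
      Real.log_div (by positivity) (by positivity)]
    ring
  have r5 : -Real.log (1 - arcValue t 5) = Real.log (1 + t) - Real.log t := by
    rw [show 1 - arcValue t 5 = t / (1 + t) by simp [arcValue]; field_simp; ring,
      Real.log_div (by positivity) (by positivity)]
    ring
  have r6 : -Real.log (1 - arcValue t 6) =
      Real.log t + Real.log (1 + t) - Real.log (1 + t + t ^ 2) := by
    rw [show 1 - arcValue t 6 = (1 + t + t ^ 2) / (t * (1 + t)) by
      simp [arcValue]; field_simp; ring, Real.log_div (by positivity) (by positivity),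
      Real.log_mul (by positivity) (by positivity)]
    ring
  have r7 : -Real.log (1 - arcValue t 7) = -Real.log (1 - t) - Real.log (1 + t) := by
    rw [show 1 - arcValue t 7 = (1 - t) * (1 + t) by simp [arcValue]; ring,
      Real.log_mul (by positivity) (by positivity)]
    ring
  have r8 : -Real.log (1 - arcValue t 8) = -Real.log (1 - t) := rfl
  funext j
  fin_cases j
  · simp [logDefect, hl 3, hl 2, hl 7, r3, r2, r7, -Complex.ofReal_neg]
  · simp [logDefect, hl 5, hl 2, hl 7, r5, r2, r7, l8, -Complex.ofReal_neg]
    ring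
  · simp [logDefect, hl 0, hl 2, hl 1, hl 7, r0, r1, r2, r7, -Complex.ofReal_neg]
    ring
  · simp [logDefect, hl 4, hl 1, hl 7, r4, r1, r7, -Complex.ofReal_neg]
  · simp [logDefect, hl 6, hl 1, hl 7, r6, r1, r7, l8, -Complex.ofReal_neg]
    ring
  · simp [logDefect, hl 7, hl 8, r7, r8, l5, -Complex.ofReal_neg]
    push_cast
    ring

/-- Since `0 ≤ log(1 + t) ≤ t`, the product is dominated by `|t log t|`. -/
theorem tendsto_log_mul_log_one_add :
    Tendsto (fun t : ℝ => Real.log t * Real.log (1 + t)) (𝓝[>] 0) (𝓝 0) := by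
  have h1 : Tendsto (fun t : ℝ => |Real.log t * t|) (𝓝[>] 0) (𝓝 0) := by
    have := (tendsto_log_mul_rpow_nhdsGT_zero zero_lt_one).abs
    simpa using this
  refine squeeze_zero_norm' ?_ h1
  filter_upwards [self_mem_nhdsWithin] with t ht
  have ht : 0 < t := ht
  rw [Real.norm_eq_abs, abs_mul, abs_mul]
  gcongr
  · exact Real.log_nonneg (by linarith)
  · have := Real.log_le_sub_one_of_pos (show 0 < 1 + t by linarith)
    linarith

theorem tendsto_dilog_zero {f : ℝ → ℝ} (hf : ContinuousAt f 0) (h0 : f 0 = 0) :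
    Tendsto (fun t => dilog (f t : ℂ)) (𝓝[>] 0) (𝓝 0) := by
  have hd : ContinuousAt dilog ((f 0 : ℝ) : ℂ) := by
    rw [h0]
    exact (hasDerivAt_dilog' (by simp)).continuousAt
  have h : ContinuousAt (fun t => dilog (f t : ℂ)) 0 :=
    ContinuousAt.comp (f := fun t => ((f t : ℝ) : ℂ)) hd
      (Complex.continuous_ofReal.continuousAt.comp hf)
  have := h.tendsto
  simp only [h0, Complex.ofReal_zero, dilog_zero] at this
  exact this.mono_left nhdsWithin_le_nhds

/-- The seventh argument runs to `-∞`; inversion trades it for an argument tending to `0`, at the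
price of a divergent squared logarithm. -/
theorem dilog_arcValue_six (ht : 0 < t) :
    dilog (arcValue t 6 : ℂ) = -((Real.pi : ℂ) ^ 2 / 6) -
      1 / 2 * ((Real.log t + Real.log (1 + t) : ℝ) : ℂ) ^ 2 -
      dilog ((-(t * (1 + t)) : ℝ) : ℂ) := by
  have h := dilog_inversion (r := t * (1 + t)) (by positivity)
  rw [Real.log_mul (by positivity) (by positivity)] at h
  have e : arcValue t 6 = -(t * (1 + t))⁻¹ := by simp [arcValue]
  rw [e]
  push_cast at h ⊢
  linear_combination h

theorem tendsto_dilogDefect_arc :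
    Tendsto (fun t => dilogDefect fun i => branch i (arcValue t i)) (𝓝[>] 0)
      (𝓝 ![-((Real.pi : ℂ) ^ 2 / 6), 0, -((Real.pi : ℂ) ^ 2 / 6)]) := by
  have hb : ∀ (t : ℝ) (i : Fin 9), (branch i (arcValue t i)).2.2 = dilog (arcValue t i) := by
    intro t i
    fin_cases i <;> rfl
  have h1 : (1 : ℝ) + 0 ≠ 0 := by norm_num
  have d0 : Tendsto (fun t => dilog (arcValue t 0 : ℂ)) (𝓝[>] 0) (𝓝 0) :=
    tendsto_dilog_zero (f := fun t => t / (1 + t) ^ 2)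
      (ContinuousAt.div (by fun_prop) (by fun_prop) (by norm_num)) (by simp)
  have d1 : Tendsto (fun t => dilog (arcValue t 1 : ℂ)) (𝓝[>] 0) (𝓝 0) :=
    tendsto_dilog_zero (f := fun t => t ^ 3) (by fun_prop) (by simp)
  have d2 : Tendsto (fun t => dilog (arcValue t 2 : ℂ)) (𝓝[>] 0) (𝓝 0) :=
    tendsto_dilog_zero (f := fun t => t) (by fun_prop) rfl
  have d3 : Tendsto (fun t => dilog (arcValue t 3 : ℂ)) (𝓝[>] 0) (𝓝 0) :=
    tendsto_dilog_zero (f := fun t => t / (1 + t))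
      (ContinuousAt.div (by fun_prop) (by fun_prop) (by norm_num)) (by simp)
  have d4 : Tendsto (fun t => dilog (arcValue t 4 : ℂ)) (𝓝[>] 0) (𝓝 0) :=
    tendsto_dilog_zero (f := fun t => -(t ^ 2 / (1 + t)))
      (ContinuousAt.div (by fun_prop) (by fun_prop) (by norm_num)).neg (by simp)
  have d5 : Tendsto (fun t => dilog (arcValue t 5 : ℂ)) (𝓝[>] 0) (𝓝 ((Real.pi : ℂ) ^ 2 / 6)) := by
    refine tendsto_dilog_one.comp (tendsto_nhdsWithin_iff.2 ⟨?_, ?_⟩)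
    · have h : ContinuousAt (fun t : ℝ => 1 / (1 + t)) 0 :=
        ContinuousAt.div (by fun_prop) (by fun_prop) (by norm_num)
      have := h.tendsto
      simp only [add_zero, div_one] at this
      exact this.mono_left nhdsWithin_le_nhds
    · filter_upwards [self_mem_nhdsWithin] with t ht
      have ht : 0 < t := ht
      exact (div_lt_one (show 0 < 1 + t by linarith)).2 (show 1 < 1 + t by linarith)
  have d7 : Tendsto (fun t => dilog (arcValue t 7 : ℂ)) (𝓝[>] 0) (𝓝 0) :=
    tendsto_dilog_zero (f := fun t => t ^ 2) (by fun_prop) (by simp)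
  have d8 : Tendsto (fun t => dilog (arcValue t 8 : ℂ)) (𝓝[>] 0) (𝓝 0) :=
    tendsto_dilog_zero (f := fun t => t) (by fun_prop) rfl
  have d6 : Tendsto (fun t => dilog ((-(t * (1 + t)) : ℝ) : ℂ)) (𝓝[>] 0) (𝓝 0) :=
    tendsto_dilog_zero (f := fun t => -(t * (1 + t))) (by fun_prop) (by simp)
  have dl : Tendsto (fun t : ℝ => ((Real.log t * Real.log (1 + t) : ℝ) : ℂ)) (𝓝[>] 0) (𝓝 0) := by
    have := (Complex.continuous_ofReal.tendsto 0).comp tendsto_log_mul_log_one_add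
    simpa [Function.comp_def] using this
  have dn : Tendsto (fun t : ℝ => ((Real.log (1 + t) ^ 2 : ℝ) : ℂ)) (𝓝[>] 0) (𝓝 0) := by
    have h : ContinuousAt (fun t : ℝ => ((Real.log (1 + t) ^ 2 : ℝ) : ℂ)) 0 :=
      Complex.continuous_ofReal.continuousAt.comp
        ((ContinuousAt.log (by fun_prop) h1).pow 2)
    have := h.tendsto
    simp only [add_zero, Real.log_one] at this
    simpa using this.mono_left nhdsWithin_le_nhds
  have l8 : ∀ t : ℝ, 0 < t → (branch 8 (arcValue t 8)).1 = ((Real.log t : ℝ) : ℂ) :=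
    fun t h0 => (Complex.ofReal_log h0.le).symm
  have l5 : ∀ t : ℝ, 0 < t → (branch 5 (arcValue t 5)).1 = -((Real.log (1 + t) : ℝ) : ℂ) := by
    intro t h0
    have : -Real.log (1 + t) = Real.log (1 / (1 + t)) := by
      rw [one_div, Real.log_inv]
    rw [← Complex.ofReal_neg, this]
    exact (Complex.ofReal_log (one_div_pos.2 (show 0 < 1 + t by linarith)).le).symm
  refine tendsto_pi_nhds.2 fun j => ?_
  fin_cases j
  · have := ((((d3.sub d8).add d7).sub d2).sub d5).add dl
    simp only [sub_zero, add_zero, zero_sub] at this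
    refine this.congr' ?_
    filter_upwards [self_mem_nhdsWithin] with t ht
    simp only [dilogDefect, hb]
    simp [l8 t ht, l5 t ht]
  -- Inversion of `Li₂(f₇)` gives `π²/6 + ½(log t + log(1+t))²`. Its `½ log² t` is cancelled by the
  -- term `-½ log² y`, and its `π²/6` by the limit of `-Li₂(f₆)`.
  · have := (((((((d0.sub d4).add_const ((Real.pi : ℂ) ^ 2 / 6)).add dl).add
      (dn.const_mul (1 / 2))).add d6).sub d3).sub d5)
    simp only [sub_zero, add_zero, mul_zero, zero_add, sub_self] at this
    refine this.congr' ?_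
    filter_upwards [self_mem_nhdsWithin] with t ht
    simp only [dilogDefect, hb, dilog_arcValue_six ht]
    simp [l8 t ht]
    ring
  -- Here the mixed term `log t · log(1+t)` from inversion cancels against `-log y · log f₆` as
  -- well, and only `-½ log²(1+t)` is left of the logarithms.
  · have := ((((((d1.add_const (-((Real.pi : ℂ) ^ 2 / 6))).sub d6).sub
      (dn.const_mul (1 / 2))).sub d7).sub d8).sub d4)
    simp only [sub_zero, mul_zero, zero_add] at this
    refine this.congr' ?_
    filter_upwards [self_mem_nhdsWithin] with t ht
    simp only [dilogDefect, hb, dilog_arcValue_six ht]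
    simp [l8 t ht, l5 t ht]
    ring

theorem functionalEquations_arc (ht : t ∈ Ioo (0 : ℝ) 1) :
    FunctionalEquations fun i => branch i (arcValue t i) := by
  refine ⟨logDefect_arc ht, ?_⟩
  let M : ℝ → Fin 9 → ℂ × ℂ × ℂ := fun t i => branch i (nineFun ((t : ℂ) ^ 2) t i)
  have hMa : ∀ t ∈ Ioo (0 : ℝ) 1, M t = fun i => branch i (arcValue t i) := fun t ht => by
    funext i
    simp only [M, nineFun_arc ht]
  have hM : ∀ t ∈ Ioo (0 : ℝ) 1, ∀ i, HasDerivAt (fun t => M t i)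
      (nineLogDeriv ((t : ℂ) ^ 2) t (2 * t) 1 i, nineLi1Deriv ((t : ℂ) ^ 2) t (2 * t) 1 i,
      (M t i).2.1 * nineLogDeriv ((t : ℂ) ^ 2) t (2 * t) 1 i) t := by
    intro t ht i
    have hc : HasDerivAt (fun t : ℝ => (t : ℂ)) 1 t := Complex.ofRealCLM.hasDerivAt
    refine (isPolylogSolution_branch i).hasDerivAt_comp_nineFun (x := fun t : ℝ => (t : ℂ) ^ 2)
      (y := fun t : ℝ => (t : ℂ)) (tanV ⟨t, ht⟩).2 ((hc.pow 2).congr_deriv (by simp)) hc i ?_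
    simp only [nineFun_arc ht]
    exact arcValue_mem_branchDomain ht i
  have hd : ∀ t ∈ Ioo (0 : ℝ) 1, HasDerivAt (fun t => dilogDefect (M t)) 0 t := fun t ht =>
    hasDerivAt_dilogDefect (hM t ht) (by rw [hMa t ht, logDefect_arc ht])
  have hconst : ∀ s ∈ Ioo (0 : ℝ) 1, dilogDefect (M s) = dilogDefect (M t) := fun s hs =>
    isOpen_Ioo.is_const_of_deriv_eq_zero isPreconnected_Ioo
      (fun s hs => (hd s hs).differentiableAt.differentiableWithinAt)
      (fun s hs => (hd s hs).deriv) hs ht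
  rw [← hMa t ht]
  -- The combination is constant on `(0, 1)`, so its value at `t` is its limit at `0+`.
  refine tendsto_nhds_unique (tendsto_const_nhds.congr' ?_) tendsto_dilogDefect_arc
  filter_upwards [Ioo_mem_nhdsGT (zero_lt_one (α := ℝ))] with s hs
  rw [← hconst s hs, hMa s hs]

end Arc

/-! ### Continuation along the paths `δ` -/

/-- One solution `B` covers the path `d` and the whole arc `c`, so continuing along `d` and then
along the connecting piece of `c` only evaluates `B`. What remains is the continuation along `g`. -/
theorem TangentialPath.continuation_comp {c e : BasePoint P1}
    {d : TangentialPath tan01 c} {g : TangentialPath c e}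
    {B : ℂ → ℂ × ℂ × ℂ} {W : Set ℂ} (hB : IsPolylogSolution B W) (hW : IsOpen W)
    (hB0 : B (d.source : ℝ) = principalPolylog (d.source : ℝ)) (hd : ∀ t, (d.path t : ℂ) ∈ W)
    (hc : ∀ t, (c t : ℂ) ∈ W) {w : ℂ × ℂ × ℂ} (h : Continuation g.path (B (c g.source)) w) :
    Continuation (d.comp g).path (principalPolylog ((d.comp g).source : ℝ)) w := by
  have h1 : Continuation d.path (principalPolylog (d.source : ℝ)) (B (c d.target)) := by
    rw [← hB0]
    exact hB.continuation hW hd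
  exact (h1.trans (hB.continuation hW (q := (germPath d.target g.source).map c.continuous)
    fun t => hc _)).trans h

theorem pathLog_pathLi₂_transport {p : VnonFano} {f : C(VnonFano, P1)}
    {d : TangentialPath tan01 (BasePoint.map f tanV)} {g : TangentialPath tanV (BasePoint.ofPoint p)}
    {B : ℂ → ℂ × ℂ × ℂ} {W : Set ℂ} (hB : IsPolylogSolution B W) (hW : IsOpen W)
    (hB0 : B (d.source : ℝ) = principalPolylog (d.source : ℝ)) (hd : ∀ t, (d.path t : ℂ) ∈ W)
    (hc : ∀ t, (BasePoint.map f tanV t : ℂ) ∈ W) {w : ℂ × ℂ × ℂ}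
    (h : Continuation (g.path.map f.continuous) (B (f (tanV g.source))) w) :
    pathLog (f p) (transport f (PathClass.mk d) (PathClass.mk g)) = w.1 ∧
      pathLi₂ (f p) (transport f (PathClass.mk d) (PathClass.mk g)) = w.2.2 := by
  have e : transport f (PathClass.mk d) (PathClass.mk g) =
      PathClass.mk (d.comp (TangentialPath.map f g)) := rfl
  have h' : Continuation (TangentialPath.map f g).path
      (B (BasePoint.map f tanV (TangentialPath.map f g).source)) w := h
  have key := TangentialPath.continuation_comp hB hW hB0 hd hc h'
  rw [e]
  exact pathLog_pathLi₂_eq (z := f p) (p := d.comp (TangentialPath.map f g)) key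

theorem exists_mk_eq_deltaStraight (c : BasePoint P1)
    (hc : ∀ t, ∃ r : ℝ, 0 < r ∧ r < 1 ∧ (c t : ℂ) = r) :
    ∃ d : TangentialPath tan01 c, PathClass.mk d = deltaStraight c hc ∧
      ∀ t : I, (d.path t : ℂ) = (1 - ((t : ℝ) : ℂ)) * (tan01 Germ.half : ℂ) +
        ((t : ℝ) : ℂ) * (c Germ.half : ℂ) :=
  ⟨_, rfl, fun _ => rfl⟩

theorem exists_mk_eq_deltaUpper (c : BasePoint P1)
    (hc : ∀ t, ∃ r : ℝ, 0 < r ∧ (c t : ℂ) = -r) :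
    ∃ d : TangentialPath tan01 c, PathClass.mk d = deltaUpper c hc ∧
      ∀ t : I, (d.path t : ℂ) =
        ((1 - (t : ℝ)) * (1 / 2) + (t : ℝ) * ‖(c Germ.half : ℂ)‖ : ℝ) *
          Complex.exp (Real.pi * Complex.I * (t : ℝ)) :=
  ⟨_, rfl, fun _ => rfl⟩

theorem pathLog_pathLi₂_transport_straight {p : VnonFano} {f : C(VnonFano, P1)}
    (hc : ∀ t, ∃ r : ℝ, 0 < r ∧ r < 1 ∧ (BasePoint.map f tanV t : ℂ) = r)
    {g : TangentialPath tanV (BasePoint.ofPoint p)} {w : ℂ × ℂ × ℂ}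
    (h : Continuation (g.path.map f.continuous) (principalPolylog (f (tanV g.source))) w) :
    pathLog (f p) (transport f (deltaStraight _ hc) (PathClass.mk g)) = w.1 ∧
      pathLi₂ (f p) (transport f (deltaStraight _ hc) (PathClass.mk g)) = w.2.2 := by
  obtain ⟨d, hd, hpath⟩ := exists_mk_eq_deltaStraight _ hc
  rw [← hd]
  refine pathLog_pathLi₂_transport isPolylogSolution_principalPolylog isOpen_doublySlitPlane rfl
    (fun t => ?_) (fun t => ?_) h
  · obtain ⟨r, h0, h1, hr⟩ := hc Germ.half
    rw [hpath, hr]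
    have hm : (1 - (t : ℝ)) * (1 / 2) + (t : ℝ) * r ∈ Ioo (0 : ℝ) 1 :=
      (convex_Ioo (0 : ℝ) 1) (x := 1 / 2) (y := r) (by norm_num) ⟨h0, h1⟩
        (sub_nonneg.2 t.2.2) t.2.1 (by ring)
    have := ofReal_mem_doublySlitPlane hm.1 hm.2
    push_cast at this
    simpa [tan01, Germ.half] using this
  · obtain ⟨r, h0, h1, hr⟩ := hc t
    rw [hr]
    exact ofReal_mem_doublySlitPlane h0 h1

theorem pathLog_pathLi₂_transport_upper {p : VnonFano} {f : C(VnonFano, P1)}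
    (hc : ∀ t, ∃ r : ℝ, 0 < r ∧ (BasePoint.map f tanV t : ℂ) = -r)
    {g : TangentialPath tanV (BasePoint.ofPoint p)} {w : ℂ × ℂ × ℂ}
    (h : Continuation (g.path.map f.continuous) (upperPolylog (f (tanV g.source))) w) :
    pathLog (f p) (transport f (deltaUpper _ hc) (PathClass.mk g)) = w.1 ∧
      pathLi₂ (f p) (transport f (deltaUpper _ hc) (PathClass.mk g)) = w.2.2 := by
  obtain ⟨d, hd, hpath⟩ := exists_mk_eq_deltaUpper _ hc
  rw [← hd]
  refine pathLog_pathLi₂_transport isPolylogSolution_upperPolylog isOpen_upperSlitPlane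
    (upperPolylog_ofReal d.source.2.1) (fun t => ?_) (fun t => ?_) h
  · obtain ⟨r, h0, hr⟩ := hc Germ.half
    obtain ⟨s, hs0, hs1⟩ := t
    rw [hpath, hr, norm_neg, Complex.norm_real, Real.norm_eq_abs, abs_of_pos h0]
    simp only
    have hR : 0 < (1 - s) * (1 / 2) + s * r :=
      (convex_Ioi (0 : ℝ)) (x := 1 / 2) (y := r) (by norm_num) h0 (sub_nonneg.2 hs1) hs0 (by ring)
    rw [show (Real.pi : ℂ) * Complex.I * (s : ℂ) = ((Real.pi * s : ℝ) : ℂ) * Complex.I by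
      push_cast; ring, mem_upperSlitPlane, Complex.re_ofReal_mul, Complex.im_ofReal_mul,
      Complex.exp_ofReal_mul_I_re, Complex.exp_ofReal_mul_I_im]
    -- The ends of the half turn are the real points `1/2` and `-r`; every intermediate point has
    -- positive imaginary part and so misses both cuts.
    rcases hs0.eq_or_lt with rfl | hs0
    · norm_num
    rcases hs1.eq_or_lt with rfl | hs1
    · simp
      exact ⟨h0.ne', by linarith⟩
    have hsin : 0 < Real.sin (Real.pi * s) :=
      Real.sin_pos_of_pos_of_lt_pi (by positivity) (by nlinarith [Real.pi_pos])
    have := mul_pos hR hsin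
    exact ⟨Or.inl this, Or.inr this.ne'⟩
  · obtain ⟨r, h0, hr⟩ := hc t
    rw [hr]
    exact neg_ofReal_mem_upperSlitPlane h0

end SpenceKummer

end

/-! ### The three functional equations. -/

open SpenceKummer in
theorem theorem4p1 (x y : ℂ)
    (hxy : x * y * (1 - x) * (1 - y) * (x - y) * (1 - x * y) ≠ 0)
    (γ₀ : PathClass tanV (BasePoint.ofPoint (⟨(x, y), hxy⟩ : VnonFano))) :
    let p : VnonFano := ⟨(x, y), hxy⟩
    let γ₁ := transport f₁ δ₁ γ₀
    let γ₂ := transport f₂ δ₂ γ₀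
    let γ₃ := transport f₃ δ₃ γ₀
    let γ₄ := transport f₄ δ₄ γ₀
    let γ₅ := transport f₅ δ₅ γ₀
    let γ₆ := transport f₆ δ₆ γ₀
    let γ₇ := transport f₇ δ₇ γ₀
    let γ₈ := transport f₈ δ₈ γ₀
    let γ₉ := transport f₉ δ₉ γ₀
    -- Schaeffer's equation
    (pathLi₂ (f₄ p) γ₄ - pathLi₂ (f₉ p) γ₉ + pathLi₂ (f₈ p) γ₈ - pathLi₂ (f₃ p) γ₃ - pathLi₂ (f₆ p) γ₆ =
      pathLog (f₉ p) γ₉ * pathLog (f₆ p) γ₆ - (Real.pi : ℂ) ^ 2 / 6) ∧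
    -- Kummer's equation
    (pathLi₂ (f₁ p) γ₁ - pathLi₂ (f₅ p) γ₅ - pathLi₂ (f₇ p) γ₇ - pathLi₂ (f₄ p) γ₄ - pathLi₂ (f₆ p) γ₆ =
      1 / 2 * pathLog (f₉ p) γ₉ ^ 2) ∧
    -- Hill's equation
    (pathLi₂ (f₇ p) γ₇ + pathLi₂ (f₂ p) γ₂ - pathLi₂ (f₈ p) γ₈ - pathLi₂ (f₉ p) γ₉ - pathLi₂ (f₅ p) γ₅ =
      -((Real.pi : ℂ) ^ 2 / 6) + pathLog (f₉ p) γ₉ * pathLog (f₆ p) γ₆ - 1 / 2 * pathLog (f₉ p) γ₉ ^ 2) := by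
  obtain ⟨g, rfl⟩ : ∃ g, PathClass.mk g = γ₀ := Quotient.exists_rep γ₀
  intro p γ₁ γ₂ γ₃ γ₄ γ₅ γ₆ γ₇ γ₈ γ₉
  -- Along each `fᵢ ∘ g.path`, start from the branch reached by `δᵢ` at the point where `g` leaves
  -- the arc. At that point the equations are already known, and `hend` carries them to the end
  -- point.
  have hL := fun i => exists_isPolylogLift (h := fun t => (nineMap i (g.path t) : ℂ))
    (by fun_prop) (fun t => (nineMap i (g.path t)).2) (branch i (nineMap i (tanV g.source)))
  choose L hL hL0 using hL
  have hL0' : (fun i => L i 0) = fun i => branch i (arcValue (g.source : ℝ) i) := by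
    funext i
    rw [hL0, nineMap_apply]
    exact congrArg (branch i) (nineFun_arc g.source.2 i)
  have hend : FunctionalEquations fun i => L i 1 :=
    functionalEquations_of_lift g.path.continuous hL
      (hL0' ▸ functionalEquations_arc g.source.2)
  have hcont : ∀ i, Continuation (g.path.map (nineMap i).continuous)
      (branch i (nineMap i (tanV g.source))) (L i 1) := fun i => ⟨L i, hL i, hL0 i, rfl⟩
  have e₁ : _ ∧ pathLi₂ (f₁ p) γ₁ = (L 0 1).2.2 :=
    pathLog_pathLi₂_transport_straight map_tanV_pos₁ (hcont 0)
  have e₂ : _ ∧ pathLi₂ (f₂ p) γ₂ = (L 1 1).2.2 :=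
    pathLog_pathLi₂_transport_straight map_tanV_pos₂ (hcont 1)
  have e₃ : _ ∧ pathLi₂ (f₃ p) γ₃ = (L 2 1).2.2 :=
    pathLog_pathLi₂_transport_straight map_tanV_pos₃ (hcont 2)
  have e₄ : _ ∧ pathLi₂ (f₄ p) γ₄ = (L 3 1).2.2 :=
    pathLog_pathLi₂_transport_straight map_tanV_pos₄ (hcont 3)
  have e₅ : _ ∧ pathLi₂ (f₅ p) γ₅ = (L 4 1).2.2 :=
    pathLog_pathLi₂_transport_upper map_tanV_neg₅ (hcont 4)
  have e₆ : pathLog (f₆ p) γ₆ = (L 5 1).1 ∧ pathLi₂ (f₆ p) γ₆ = (L 5 1).2.2 :=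
    pathLog_pathLi₂_transport_straight map_tanV_pos₆ (hcont 5)
  have e₇ : _ ∧ pathLi₂ (f₇ p) γ₇ = (L 6 1).2.2 :=
    pathLog_pathLi₂_transport_upper map_tanV_neg₇ (hcont 6)
  have e₈ : _ ∧ pathLi₂ (f₈ p) γ₈ = (L 7 1).2.2 :=
    pathLog_pathLi₂_transport_straight map_tanV_pos₈ (hcont 7)
  have e₉ : pathLog (f₉ p) γ₉ = (L 8 1).1 ∧ pathLi₂ (f₉ p) γ₉ = (L 8 1).2.2 :=
    pathLog_pathLi₂_transport_straight map_tanV_pos₉ (hcont 8)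
  have d0 := congrFun hend.2 0
  have d1 := congrFun hend.2 1
  have d2 := congrFun hend.2 2
  simp [dilogDefect] at d0 d1 d2
  rw [e₁.2, e₂.2, e₃.2, e₄.2, e₅.2, e₆.2, e₇.2, e₈.2, e₉.2, e₆.1, e₉.1]
  refine ⟨?_, ?_, ?_⟩
  · linear_combination d0
  · linear_combination d1
  · linear_combination d2
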